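/- **Theorem (Sample complexity of the DP line search algorithm).** *Setting.* Let $f(w)=\frac1n\sum_{i=1}^n l(w,x_i)$ on $\mathbb R^d$ ($d,n\ge 1$), where for every data point $x$ the loss $l(\cdot,x)$ is $C^2$ with $G$-Lipschitz gradient and $M$-Lipschitz Hessian ($G,M>0$) and $0\le l\le B$, $\|\nabla_w l\|\le B_g$, $\|\nabla^2_w l\|\le B_H$ (2-norms). Let $\underline f\le f$, let $\varepsilon_g,\varepsilon_H>0$, and put $\Delta_f=B/n$, $\Delta_g=2B_g/n$, $\Delta_H=2B_H\sqrt d/n$. A point $w$ is an $(\varepsilon,\varepsilon')$-2S if $\|\nabla f(w)\|\le\varepsilon$ and $\lambda_{\min}(\nabla^2f(w))\ge-\varepsilon'$. Let $c,c_1,c_2>0$, $c_g\in(0,1-c_1)$, $c_H\in(0,1-c-\sqrt{8c_2/3})$; let $t_1<t_2$ be $\frac32(1-c-c_H)\mp3\sqrt{\frac14(1-c-c_H)^2-\frac23c_2}$; let $b_g,b_H>1$, $\beta_g\in(0,1)$, $\beta_H\in(t_1/t_2,1)$. Put $$\mathrm{MIN\_DEC}=\min\Big(\tfrac1G(1-c_1-c_g)c_g\varepsilon_g^2,\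 \tfrac14c_Ht_2^2\tfrac{\varepsilon_H^3}{M^2}\Big),\qquad i_{\max}=\max_{j\in\{g,H\}}\big(\lfloor\log_{\beta_j}(1/b_j)\rfloor+1\big).$$ *Algorithm.* Start at $w_0$, sample $z\sim N(0,\Delta_f^2\sigma_f^2)$ and set $T=\lceil (f(w_0)+|z|-\underline f)/\mathrm{MIN\_DEC}\rceil$. The parameters $\sigma_g,\sigma_H,\lambda\ge0$ may depend on $T$. For $k=0,\dots,T-1$: let $\tilde g=\nabla f(w_k)+N(0,\Delta_g^2\sigma_g^2I_d)$. If $\|\tilde g\|>\varepsilon_g$, set $w_{k+1}=w_k-\gamma\tilde g$, where $\gamma$ is the result of the line search below for $q(\gamma)=f(w_k)-f(w_k-\gamma\tilde g)-c_g\gamma\|\tilde g\|^2$, $\bar\gamma=2(1-c_1-c_g)/G$, $\gamma^{\rm init}=b_g\bar\gamma$, $\beta=\beta_g$, $\Delta_q=\frac2n\gamma^{\rm init}B_g\|\tilde g\|$. Otherwise let $\tilde H=\nabla^2f(w_k)+E$, $E$ symmetric with i.i.d. $N(0,\Delta_H^2\sigma_H^2)$ entries on and above the diagonal, let $\tilde\lambda$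 be its smallest eigenvalue and $\tilde p$ a unit eigenvector for it with $\tilde p^{T}\tilde g\le0$. If $\tilde\lambda<-\varepsilon_H$, set $w_{k+1}=w_k+\gamma\tilde p$, with $\gamma$ from the line search for $q(\gamma)=f(w_k)-f(w_k+\gamma\tilde p)-\frac12c_H\gamma^2|\tilde\lambda|$, $\bar\gamma=t_2|\tilde\lambda|/M$, $\gamma^{\rm init}=b_H\bar\gamma$, $\beta=\beta_H$, $\Delta_q=\frac2n\gamma^{\rm init}B_g$; else return $w_k$. *Line search:* sample a threshold $\theta\sim\mathrm{Lap}(2\lambda\Delta_q)$; for $i=1,\dots,\lfloor\log_\beta(\bar\gamma/\gamma^{\rm init})\rfloor+1$ and $\gamma=\beta^{i-1}\gamma^{\rm init}$, sample $\nu_i\sim\mathrm{Lap}(4\lambda\Delta_q)$ and output $\gamma$ as soon as $q(\gamma)+\nu_i\ge\theta$; if this never happens output $\bar\gamma$. All samples are independent. *Claim.* There are universal constants $C,C_1>0$ with $Ce^{-C_1C}<1$ that satisfy the Wigner tail bound $\mathbf P(\|W\|>A\sqrt d)\le Ce^{-C_1Ad}$ for all $d$ and all $A\ge C$ ($W$ symmetric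 $d\times d$, i.i.d. $N(0,1)$ on and above the diagonal), and for which the following holds. (1) Let $\zeta,\xi>0$ and $$n_{\min}=\max\Big(\frac{2\sqrt{2d}\,B_g\sigma_g\log\frac T\zeta}{\min(c_1\varepsilon_g,\frac{c_2}M\varepsilon_H^2)},\ \frac{2Cd\,B_H\sigma_H\log\frac T\zeta}{c\,\varepsilon_H},\ 16\lambda\big(\log i_{\max}+\log\tfrac T\xi\big)B_g\max\Big(\frac{2b_g}{c_g\varepsilon_g},\frac{4b_HM}{t_2c_H\varepsilon_H^2}\Big)\Big).$$ For every value of $z$ with $\log\frac T\zeta\ge1$, $\xi\le T$ and $n\ge n_{\min}$, conditionally on $z$ the algorithm outputs a $((1+c_1)\varepsilon_g,(1+c)\varepsilon_H)$-2S with probability at least $\{(1-\frac\zeta T)(1-Ce^{-C_1Cd})(1-\frac\xi T)\}^T$. Consequently the joint probability that $z$ satisfies these conditions and that the output is such a point is at least the integral of this bound over these $z$ against the law of $z$. (2) Let $\sigma_f^2=\frac1{2\rho_f}$ and $\sigma_g^2=\sigma_H^2=\lambda^2=\frac{3T}{2(\rho-\rho_f)}$ with $\rho>0$, $0<\rho_f\le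 c_f\rho$, where $c_f\in(0,1)$. For every $F>0$ there is a constant $K$, depending only on $F$, $c_f$, $\zeta$, $\xi$, $G$, $M$, $B$, $B_g$, $B_H$ and the parameters $c,c_1,c_2,c_g,c_H,b_g,b_H,\beta_g,\beta_H$ (not on $d,n,\rho,\rho_f,\varepsilon_g,\varepsilon_H$, the loss or the data), such that whenever $\varepsilon_g,\varepsilon_H\le1$ and $f(w_0)+|z|-\underline f\le F$, $$n_{\min}\le K\max(1,\sqrt d\,\varepsilon_H)\,\frac{\sqrt d}{\sqrt\rho}\,\big(1+\log\tfrac1{\varepsilon_g}+\log\tfrac1{\varepsilon_H}\big)\max\big(\varepsilon_g^{-2},\varepsilon_g^{-1}\varepsilon_H^{-2},\varepsilon_H^{-7/2}\big).$$ In particular $n_{\min}=\frac{\sqrt d}{\sqrt\rho}\tilde O(\max(\varepsilon_g^{-2},\varepsilon_g^{-1}\varepsilon_H^{-2},\varepsilon_H^{-7/2}))$, with a constant independent of $d$ as soon as $\varepsilon_H\le1/\sqrt d$. -/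

import Mathlib

open MeasureTheory ProbabilityTheory

universe u

noncomputable section

namespace DPOpt

/-! ### Derivatives, spectral norm, smallest eigenvalue -/

/-- `ℝ^d` with the Euclidean norm. -/
abbrev Vec (d : ℕ) : Type := EuclideanSpace ℝ (Fin d)

/-- The matrix 2-norm (operator norm for the Euclidean norm). -/
def opNorm {d : ℕ} (A : Matrix (Fin d) (Fin d) ℝ) : ℝ :=
  ‖Matrix.toEuclideanCLM (n := Fin d) (𝕜 := ℝ) A‖

/-- The smallest (real) eigenvalue of a matrix; only used for symmetric matrices of size `≥ 1`. -/
def minEig {d : ℕ} (A : Matrix (Fin d) (Fin d) ℝ) : ℝ := sInf (spectrum ℝ A)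

/-- The Hessian matrix of `f` at `w`: the matrix of the derivative of the gradient. -/
def hessian {d : ℕ} (f : Vec d → ℝ) (w : Vec d) : Matrix (Fin d) (Fin d) ℝ :=
  (Matrix.toEuclideanCLM (n := Fin d) (𝕜 := ℝ)).symm (fderiv ℝ (gradient f) w)

/-- `w` is an `(εg, εH)`-approximate second-order solution (an `(εg, εH)`-2S) for `f`. -/
def Is2S {d : ℕ} (f : Vec d → ℝ) (εg εH : ℝ) (w : Vec d) : Prop :=
  ‖gradient f w‖ ≤ εg ∧ -εH ≤ minEig (hessian f w)

/-! ### Empirical risk minimization -/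

/-- The empirical risk `L(w, D) = (1/n) ∑ᵢ l(w, xᵢ)`. -/
def risk {X : Type u} {d n : ℕ} (l : Vec d → X → ℝ) (D : Fin n → X) (w : Vec d) : ℝ :=
  (1 / (n : ℝ)) * ∑ i, l w (D i)

/-- Problem constants and scalar parameters of the line search algorithm. -/
structure Params where
  /-- Lipschitz constant of the gradient -/
  G : ℝ
  /-- Lipschitz constant of the Hessian -/
  M : ℝ
  /-- bound on the loss -/
  B : ℝ
  /-- bound on the gradient of the loss -/
  Bg : ℝ
  /-- bound on the Hessian of the loss -/
  BH : ℝ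
  /-- noise bound parameters -/
  c : ℝ
  c1 : ℝ
  c2 : ℝ
  /-- sufficient decrease parameters -/
  cg : ℝ
  cH : ℝ
  /-- initial step size multipliers -/
  bg : ℝ
  bH : ℝ
  /-- backtracking factors -/
  βg : ℝ
  βH : ℝ

/-- The smaller root of `-t²/6 + (1 - c - cH) t / 2 - c2 = 0`. -/
def Params.t1 (p : Params) : ℝ :=
  3 / 2 * (1 - p.c - p.cH) - 3 * Real.sqrt (1 / 4 * (1 - p.c - p.cH) ^ 2 - 2 / 3 * p.c2)

/-- The larger root of `-t²/6 + (1 - c - cH) t / 2 - c2 = 0`. -/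
def Params.t2 (p : Params) : ℝ :=
  3 / 2 * (1 - p.c - p.cH) + 3 * Real.sqrt (1 / 4 * (1 - p.c - p.cH) ^ 2 - 2 / 3 * p.c2)

/-- The conditions on the scalar parameters. -/
structure Params.Valid (p : Params) : Prop where
  G_pos : 0 < p.G
  M_pos : 0 < p.M
  B_nonneg : 0 ≤ p.B
  Bg_nonneg : 0 ≤ p.Bg
  BH_nonneg : 0 ≤ p.BH
  c_pos : 0 < p.c
  c1_pos : 0 < p.c1
  c2_pos : 0 < p.c2
  cg_pos : 0 < p.cg
  cg_lt : p.cg < 1 - p.c1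
  cH_pos : 0 < p.cH
  cH_lt : p.cH < 1 - p.c - Real.sqrt (8 / 3 * p.c2)
  bg_gt : 1 < p.bg
  bH_gt : 1 < p.bH
  βg_pos : 0 < p.βg
  βg_lt : p.βg < 1
  βH_gt : p.t1 / p.t2 < p.βH
  βH_lt : p.βH < 1

/-- The loss is twice continuously differentiable in `w`, `G`-smooth with `M`-Lipschitz Hessian,
and has bounded values, gradients and Hessians. -/
structure LossAssumption (p : Params) {X : Type u} {d : ℕ} (l : Vec d → X → ℝ) : Prop where
  contDiff : ∀ x, ContDiff ℝ 2 (fun w => l w x)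
  nonneg : ∀ w x, 0 ≤ l w x
  le_B : ∀ w x, l w x ≤ p.B
  grad_le : ∀ w x, ‖gradient (fun v => l v x) w‖ ≤ p.Bg
  hess_le : ∀ w x, opNorm (hessian (fun v => l v x) w) ≤ p.BH
  grad_lip : ∀ x w₁ w₂,
    ‖gradient (fun v => l v x) w₁ - gradient (fun v => l v x) w₂‖ ≤ p.G * ‖w₁ - w₂‖
  hess_lip : ∀ x w₁ w₂,
    opNorm (hessian (fun v => l v x) w₁ - hessian (fun v => l v x) w₂) ≤ p.M * ‖w₁ - w₂‖

/-- Sensitivities of the empirical risk, its gradient and its Hessian. -/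
def Params.Δf (p : Params) (n : ℕ) : ℝ := p.B / n

def Params.Δg (p : Params) (n : ℕ) : ℝ := 2 * p.Bg / n

def Params.ΔH (p : Params) (d n : ℕ) : ℝ := 2 * p.BH * Real.sqrt d / n

/-- The minimum decrease `MIN_DEC` per iteration. -/
def Params.minDec (p : Params) (εg εH : ℝ) : ℝ :=
  min (1 / p.G * (1 - p.c1 - p.cg) * p.cg * εg ^ 2)
    (1 / 4 * p.cH * p.t2 ^ 2 * (εH ^ 3 / p.M ^ 2))

/-- The iteration bound `⌈gap / MIN_DEC⌉`. -/
def Params.iterBound (p : Params) (εg εH gap : ℝ) : ℕ := ⌈gap / p.minDec εg εH⌉₊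

/-- The maximal number of queries in a line search,
for gradient steps and negative curvature steps together. -/
def Params.imax (p : Params) : ℕ :=
  max (⌊Real.logb p.βg (1 / p.bg)⌋₊ + 1) (⌊Real.logb p.βH (1 / p.bH)⌋₊ + 1)

/-- The required sample size (with `T` the iteration bound and `C` the constant of the tail bound
for Gaussian Wigner matrices). -/
def Params.nMin (p : Params) (C : ℝ) (d : ℕ) (εg εH ζ ξ σg σH lam : ℝ) (T : ℕ) : ℝ :=
  max
    (max
      (2 * Real.sqrt (2 * d) * p.Bg * σg * Real.log (T / ζ) / min (p.c1 * εg) (p.c2 / p.M * εH ^ 2))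
      (2 * C * d * p.BH * σH * Real.log (T / ζ) / (p.c * εH)))
    (16 * lam * (Real.log p.imax + Real.log (T / ξ)) * p.Bg *
      max (2 * p.bg / (p.cg * εg)) (4 * p.bH * p.M / (p.t2 * p.cH * εH ^ 2)))

/-! ### Noise

All noise is obtained by scaling standard Gaussian and standard Laplace variables, which are
sampled independently of each other. -/

/-- The standard Laplace distribution `Lap(1)`, with density `exp (-|x|) / 2`;
`Lap(b)` is the law of `b` times a variable with this distribution. -/
def laplaceStd : Measure ℝ :=
  (volume : Measure ℝ).withDensity fun x => ENNReal.ofReal (Real.exp (-|x|) / 2)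

/-- Standard noise available to one iteration: a Gaussian vector, Gaussian matrix entries, the
Laplace variable for the threshold, and Laplace variables for the queries of the line search. -/
abbrev IterNoise (d : ℕ) : Type :=
  (Fin d → ℝ) × (Fin d → Fin d → ℝ) × ℝ × (ℕ → ℝ)

/-- The law of a `d × d` array with i.i.d. standard Gaussian entries. -/
def gaussArray (d : ℕ) : Measure (Fin d → Fin d → ℝ) :=
  Measure.pi fun _ => Measure.pi fun _ => gaussianReal 0 1

def iterNoiseLaw (d : ℕ) : Measure (IterNoise d) :=
  (Measure.pi fun _ : Fin d => gaussianReal 0 1).prod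
    ((gaussArray d).prod (laplaceStd.prod (Measure.infinitePi fun _ : ℕ => laplaceStd)))

/-- The law of the standard noise of all iterations (independent across iterations). -/
def noiseLaw (d : ℕ) : Measure (ℕ → IterNoise d) :=
  Measure.infinitePi fun _ : ℕ => iterNoiseLaw d

/-- The symmetric matrix whose entries on and above the diagonal are those of `e`. -/
def symMat {d : ℕ} (e : Fin d → Fin d → ℝ) : Matrix (Fin d) (Fin d) ℝ :=
  Matrix.of fun i j => if i ≤ j then e i j else e j i

/-- `C, C₁` are constants for the upper tail estimate for the norm of a symmetric random matrix
whose entries on and above the diagonal are i.i.d. standard Gaussian. -/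
def WignerTail (C C₁ : ℝ) : Prop :=
  ∀ (d : ℕ) (A : ℝ), C ≤ A →
    gaussArray d {e | A * Real.sqrt d < opNorm (symMat e)} ≤
      ENNReal.ofReal (C * Real.exp (-C₁ * A * d))

/-! ### The algorithm -/

/-- The backtracking loop with `m` trials left; `s` is the Laplace scale of the query noise. -/
def svtLoop (q : ℝ → ℝ) (thr s γbar β : ℝ) (ν : ℕ → ℝ) : ℕ → ℕ → ℝ → ℝ
  | 0, _, _ => γbar
  | m + 1, i, γ =>
      if thr ≤ q γ + s * ν i then γ else svtLoop q thr s γbar β ν m (i + 1) (β * γ)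

/-- Private backtracking line search using the sparse vector technique: threshold noise
`Lap(2 λ Δ)`, query noise `Lap(4 λ Δ)`. -/
def dpLineSearch (q : ℝ → ℝ) (Δ γinit γbar β lam : ℝ) (x : ℝ) (ν : ℕ → ℝ) : ℝ :=
  svtLoop q (2 * lam * Δ * x) (4 * lam * Δ) γbar β ν
    (⌊Real.logb β (γbar / γinit)⌋₊ + 1) 0 γinit

/-- A rule that returns, for a symmetric `A` and a vector `v`, a unit eigenvector of `A` for its
smallest eigenvalue, with sign chosen so that its inner product with `v` is `≤ 0`. -/
def IsMinEigSolver {d : ℕ} (eig : Matrix (Fin d) (Fin d) ℝ → Vec d → Vec d) : Prop :=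
  ∀ A v, A.IsSymm →
    ‖eig A v‖ = 1 ∧
    Matrix.toEuclideanCLM (n := Fin d) (𝕜 := ℝ) A (eig A v) = minEig A • eig A v ∧
    inner ℝ (eig A v) v ≤ 0

/-- Everything the algorithm is given. The noise parameters `σg`, `σH`, `lam` may depend on the
iteration bound `T` computed by the algorithm. -/
structure Setup (X : Type u) (d n : ℕ) where
  p : Params
  εg : ℝ
  εH : ℝ
  l : Vec d → X → ℝ
  D : Fin n → X
  /-- lower bound for the empirical risk -/
  flow : ℝ
  w0 : Vec d
  σf : ℝ
  σg : ℕ → ℝ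
  σH : ℕ → ℝ
  lam : ℕ → ℝ
  eig : Matrix (Fin d) (Fin d) ℝ → Vec d → Vec d

namespace Setup

variable {X : Type u} {d n : ℕ}

/-- The objective function. -/
def f (S : Setup X d n) : Vec d → ℝ := risk S.l S.D

structure Valid (S : Setup X d n) : Prop where
  d_pos : 0 < d
  n_pos : 0 < n
  params : S.p.Valid
  loss : LossAssumption S.p S.l
  flow_le : ∀ w, S.flow ≤ S.f w
  εg_pos : 0 < S.εg
  εH_pos : 0 < S.εH
  σf_nonneg : 0 ≤ S.σf
  σg_nonneg : ∀ T, 0 ≤ S.σg T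
  σH_nonneg : ∀ T, 0 ≤ S.σH T
  lam_nonneg : ∀ T, 0 ≤ S.lam T
  solver : IsMinEigSolver S.eig

/-- The iteration bound computed from the sampled value `z`. -/
def T (S : Setup X d n) (z : ℝ) : ℕ := S.p.iterBound S.εg S.εH (S.f S.w0 + |z| - S.flow)

/-- The law `N(0, Δf² σf²)` of `z`. -/
def zLaw (S : Setup X d n) : Measure ℝ := gaussianReal 0 ((S.p.Δf n * S.σf) ^ 2).toNNReal

/-- The perturbed gradient at `w`. -/
def noisyGrad (S : Setup X d n) (T : ℕ) (w : Vec d) (η : IterNoise d) : Vec d :=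
  gradient S.f w + (S.p.Δg n * S.σg T) • WithLp.toLp 2 η.1

/-- The perturbed Hessian at `w`. -/
def noisyHess (S : Setup X d n) (T : ℕ) (w : Vec d) (η : IterNoise d) :
    Matrix (Fin d) (Fin d) ℝ :=
  hessian S.f w + (S.p.ΔH d n * S.σH T) • symMat η.2.1

/-- The gradient step from `w` along the perturbed gradient `g`. -/
def gradStep (S : Setup X d n) (T : ℕ) (w g : Vec d) (η : IterNoise d) : Vec d :=
  let γbar := 2 * (1 - S.p.c1 - S.p.cg) / S.p.G
  let γinit := S.p.bg * γbar
  let q := fun γ : ℝ => S.f w - S.f (w - γ • g) - S.p.cg * γ * ‖g‖ ^ 2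
  let Δq := 2 / n * γinit * S.p.Bg * ‖g‖
  w - dpLineSearch q Δq γinit γbar S.p.βg (S.lam T) η.2.2.1 η.2.2.2 • g

/-- The negative curvature step from `w` along `v`, where `μ` is the perturbed smallest
eigenvalue. -/
def curvStep (S : Setup X d n) (T : ℕ) (w : Vec d) (μ : ℝ) (v : Vec d) (η : IterNoise d) :
    Vec d :=
  let γbar := S.p.t2 * |μ| / S.p.M
  let γinit := S.p.bH * γbar
  let q := fun γ : ℝ => S.f w - S.f (w + γ • v) - 1 / 2 * S.p.cH * γ ^ 2 * |μ|
  let Δq := 2 / n * γinit * S.p.Bg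
  w + dpLineSearch q Δq γinit γbar S.p.βH (S.lam T) η.2.2.1 η.2.2.2 • v

open Classical in
/-- The main loop with `m` iterations left, at iteration `k` and iterate `w`; the value is `none`
if the loop ends without returning a point. -/
def loop (S : Setup X d n) (T : ℕ) (ω : ℕ → IterNoise d) : ℕ → ℕ → Vec d → Option (Vec d)
  | 0, _, _ => none
  | m + 1, k, w =>
      if S.εg < ‖S.noisyGrad T w (ω k)‖ then
        loop S T ω m (k + 1) (S.gradStep T w (S.noisyGrad T w (ω k)) (ω k))
      else if minEig (S.noisyHess T w (ω k)) < -S.εH then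
        loop S T ω m (k + 1)
          (S.curvStep T w (minEig (S.noisyHess T w (ω k)))
            (S.eig (S.noisyHess T w (ω k)) (S.noisyGrad T w (ω k))) (ω k))
      else some w

/-- The output of the differentially private optimization algorithm with backtracking line search,
given the sampled value `z` and the standard noise `ω` of all iterations. -/
def output (S : Setup X d n) (z : ℝ) (ω : ℕ → IterNoise d) : Option (Vec d) :=
  S.loop (S.T z) ω (S.T z) 0 S.w0

/-- The algorithm returns a `((1 + c₁) εg, (1 + c) εH)`-2S. -/
def Success (S : Setup X d n) (z : ℝ) (ω : ℕ → IterNoise d) : Prop :=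
  ∃ w, S.output z ω = some w ∧ Is2S S.f ((1 + S.p.c1) * S.εg) ((1 + S.p.c) * S.εH) w

/-- The required sample size for the iteration bound `T` computed from `z`. -/
def nMin (S : Setup X d n) (C ζ ξ z : ℝ) : ℝ :=
  S.p.nMin C d S.εg S.εH ζ ξ (S.σg (S.T z)) (S.σH (S.T z)) (S.lam (S.T z)) (S.T z)

/-- The sample size `n` is at least `n_min` for the iteration bound `T` computed from `z`, and the
failure levels satisfy `log (T / ζ) ≥ 1` and `ξ ≤ T`. -/
def Admissible (S : Setup X d n) (C ζ ξ z : ℝ) : Prop :=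
  Real.exp 1 * ζ ≤ S.T z ∧ ξ ≤ S.T z ∧ S.nMin C ζ ξ z ≤ n

/-- The choice of the noise parameters for the privacy budget `ρ`, with the part `ρf` spent on the
function value. -/
structure PrivacyChoice (S : Setup X d n) (ρ ρf : ℝ) : Prop where
  σf_eq : S.σf = Real.sqrt (1 / (2 * ρf))
  σg_eq : ∀ T : ℕ, S.σg T = Real.sqrt (3 * T / (2 * (ρ - ρf)))
  σH_eq : ∀ T : ℕ, S.σH T = Real.sqrt (3 * T / (2 * (ρ - ρf)))
  lam_eq : ∀ T : ℕ, S.lam T = Real.sqrt (3 * T / (2 * (ρ - ρf)))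

end Setup

/-- The probability `{(1 - ζ/T) (1 - C exp (-C₁ C d)) (1 - ξ/T)}^T`. -/
def successProb (C C₁ : ℝ) (d : ℕ) (ζ ξ : ℝ) (T : ℕ) : ℝ :=
  ((1 - ζ / T) * (1 - C * Real.exp (-C₁ * C * d)) * (1 - ξ / T)) ^ T

/-! ### The noise laws are probability measures -/

instance : IsProbabilityMeasure laplaceStd := by
  have h1 : ∫ x : ℝ, Real.exp (-|x|) / 2 = 1 := by
    rw [integral_div, integral_comp_abs (f := fun x => Real.exp (-x)), integral_exp_neg_Ioi_zero]
    norm_num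
  have h2 : Integrable (fun x : ℝ => Real.exp (-|x|) / 2) := by
    by_contra h
    rw [integral_undef h] at h1
    exact zero_ne_one h1
  constructor
  rw [laplaceStd, withDensity_apply _ MeasurableSet.univ, Measure.restrict_univ,
    ← ofReal_integral_eq_lintegral_ofReal h2 (Filter.Eventually.of_forall fun x => by positivity),
    h1, ENNReal.ofReal_one]

instance (d : ℕ) : IsProbabilityMeasure (gaussArray d) := by
  unfold gaussArray; infer_instance

instance (d : ℕ) : IsProbabilityMeasure (iterNoiseLaw d) := by
  unfold iterNoiseLaw; infer_instance

instance (d : ℕ) : IsProbabilityMeasure (noiseLaw d) := by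
  unfold noiseLaw; infer_instance

end DPOpt

end

namespace DPOpt

/-! Once the noise is bounded, the analysis is deterministic. The standard noise does not depend on
the iterates, so one fixed set `goodNoise` serves every iteration, whatever point has been reached.
No conditioning on the past is needed, and independence turns the bound for one iteration into its
T-th power.

On this event, n ≥ n_min keeps the gradient error below c₁ε_g and c₂ε_H²/M and the Hessian error
below cε_H, and lets the Laplace noise consume at most half of the sufficient decrease
(`smallNoise_of_mem_goodNoise`, `f_gradStep_lt`, `f_curvStep_lt`). The line search never tests a
step shorter than γ̄ (`dpLineSearch_spec`). An accepted step therefore gains at least the decrease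
prescribed at γ̄, up to noise. The fallback γ̄ gains it without any loss, by Taylor expansion
(`le_quadratic_of_gradient_lipschitz`, `le_cubic_of_hessian_lipschitz`); for negative curvature this
is where t₂ being a root matters. Either way f drops by more than MIN_DEC. After T such drops f
would lie below its lower bound, so the loop must return a point, and there the perturbed stopping
test, the triangle inequality and Weyl's inequality give the 2S property (`loop_spec`,
`success_of_smallNoise`).

Three tail bounds control the probability. The Gaussian vector is handled by induction from the
exact tail in the plane (`gaussVec_norm_tail`), the Wigner matrix by a net and Chernoff's bound
(`wignerTail`), and the Laplace noise by Bernoulli's inequality (`laplace_line_search_tail`).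

For the order of n_min, T = O(max(ε_g⁻², ε_H⁻³)), so the noise scale is O(max(ε_g⁻¹,
ε_H^(-3/2))/√ρ). Multiplying by the reciprocal tolerances max(ε_g⁻¹, ε_H⁻²) yields the stated powers
(`exists_nMin_le`). -/

/-! ### Tail of the norm of a standard Gaussian vector -/

open Set Filter Topology in
lemma lintegral_Ioi_mul_exp_neg_sq_half {a : ℝ} (ha : 0 ≤ a) :
    ∫⁻ r in Ioi a, ENNReal.ofReal (r * Real.exp (-r ^ 2 / 2)) =
      ENNReal.ofReal (Real.exp (-a ^ 2 / 2)) := by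
  have hd : ∀ x ∈ Ici a, HasDerivAt (fun r : ℝ => -Real.exp (-r ^ 2 / 2))
      (x * Real.exp (-x ^ 2 / 2)) x := by
    intro x _
    have h := ((((hasDerivAt_id x).pow 2).neg.div_const 2).exp).neg
    refine h.congr_deriv ?_
    simp only [Pi.neg_apply, Pi.pow_apply, id]
    norm_num
    ring
  have hnn : ∀ x ∈ Ioi a, 0 ≤ x * Real.exp (-x ^ 2 / 2) := fun x hx =>
    mul_nonneg (ha.trans (le_of_lt hx)) (Real.exp_nonneg _)
  have hlim : Tendsto (fun r : ℝ => -Real.exp (-r ^ 2 / 2)) atTop (𝓝 0) := by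
    rw [← neg_zero]
    refine (Real.tendsto_exp_atBot.comp ?_).neg
    have : Tendsto (fun r : ℝ => r ^ 2 / 2) atTop atTop :=
      (tendsto_pow_atTop two_ne_zero).atTop_div_const two_pos
    refine (tendsto_neg_atTop_atBot.comp this).congr fun r => ?_
    simp [neg_div]
  have hint := integrableOn_Ioi_deriv_of_nonneg' hd hnn hlim
  have heq := integral_Ioi_of_hasDerivAt_of_nonneg' hd hnn hlim
  rw [← ofReal_integral_eq_lintegral_ofReal hint
    ((ae_restrict_iff' measurableSet_Ioi).2 (Eventually.of_forall hnn)), heq]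
  simp

/-- The tail of the squared norm of a standard Gaussian vector in the plane. -/
lemma gaussian_prod_sq_tail {t : ℝ} (ht : 0 ≤ t) :
    ((gaussianReal 0 1).prod (gaussianReal 0 1)) {p : ℝ × ℝ | t < p.1 ^ 2 + p.2 ^ 2} =
      ENNReal.ofReal (Real.exp (-t / 2)) := by
  have hms : MeasurableSet {p : ℝ × ℝ | t < p.1 ^ 2 + p.2 ^ 2} :=
    measurableSet_lt measurable_const (by fun_prop)
  rw [gaussianReal_of_var_ne_zero _ one_ne_zero,
    prod_withDensity (measurable_gaussianPDF 0 1) (measurable_gaussianPDF 0 1),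
    withDensity_apply _ hms, ← lintegral_indicator hms, ← Measure.volume_eq_prod,
    ← lintegral_comp_polarCoord_symm, polarCoord_target]
  -- In polar coordinates the Jacobian r gives the radial density an elementary primitive; the angle
  -- contributes the factor (2π)⁻¹ · 2π = 1.
  have hfun : ∀ p ∈ Set.Ioi (0 : ℝ) ×ˢ Set.Ioo (-Real.pi) Real.pi,
      ENNReal.ofReal p.1 • ({p : ℝ × ℝ | t < p.1 ^ 2 + p.2 ^ 2}.indicator
        (fun a => gaussianPDF 0 1 a.1 * gaussianPDF 0 1 a.2) (polarCoord.symm p)) =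
      (Set.Ioi (√t)).indicator (fun r => ENNReal.ofReal (r * Real.exp (-r ^ 2 / 2))) p.1 *
        ENNReal.ofReal (2 * Real.pi)⁻¹ := by
    rintro ⟨r, θ⟩ ⟨hr, -⟩
    have hr : 0 < r := hr
    have hsq : (r * Real.cos θ) ^ 2 + (r * Real.sin θ) ^ 2 = r ^ 2 := by
      rw [mul_pow, mul_pow, ← mul_add, Real.cos_sq_add_sin_sq, mul_one]
    have hiff : r ∈ Set.Ioi (√t) ↔
        polarCoord.symm (r, θ) ∈ {p : ℝ × ℝ | t < p.1 ^ 2 + p.2 ^ 2} := by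
      simp only [Set.mem_Ioi, polarCoord_symm_apply, Set.mem_ofPred_eq, hsq]
      exact Real.sqrt_lt' hr
    by_cases h : r ∈ Set.Ioi (√t)
    · rw [Set.indicator_of_mem h, Set.indicator_of_mem (hiff.1 h)]
      simp only [polarCoord_symm_apply, gaussianPDF, smul_eq_mul]
      rw [← ENNReal.ofReal_mul (gaussianPDFReal_nonneg _ _ _), ← ENNReal.ofReal_mul hr.le,
        ← ENNReal.ofReal_mul (by positivity)]
      congr 1
      simp only [gaussianPDFReal, NNReal.coe_one, mul_one, sub_zero]
      have h2 : (√(2 * Real.pi))⁻¹ * (√(2 * Real.pi))⁻¹ = (2 * Real.pi)⁻¹ := by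
        rw [← mul_inv, Real.mul_self_sqrt (by positivity)]
      calc r * ((√(2 * Real.pi))⁻¹ * Real.exp (-(r * Real.cos θ) ^ 2 / 2) *
            ((√(2 * Real.pi))⁻¹ * Real.exp (-(r * Real.sin θ) ^ 2 / 2)))
          = r * (Real.exp (-(r * Real.cos θ) ^ 2 / 2) * Real.exp (-(r * Real.sin θ) ^ 2 / 2)) *
            ((√(2 * Real.pi))⁻¹ * (√(2 * Real.pi))⁻¹) := by ring
        _ = _ := by
            rw [h2, ← Real.exp_add]
            congr 3
            rw [← hsq]; ring
    · rw [Set.indicator_of_notMem h, Set.indicator_of_notMem (fun h' => h (hiff.2 h'))]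
      simp
  rw [setLIntegral_congr_fun (measurableSet_Ioi.prod measurableSet_Ioo) hfun,
    Measure.volume_eq_prod, ← Measure.prod_restrict,
    lintegral_prod_mul (Measurable.aemeasurable (Measurable.indicator (by fun_prop)
      measurableSet_Ioi)) aemeasurable_const,
    setLIntegral_indicator measurableSet_Ioi,
    Set.inter_eq_left.2 (Set.Ioi_subset_Ioi (Real.sqrt_nonneg t)),
    lintegral_Ioi_mul_exp_neg_sq_half (Real.sqrt_nonneg t), Real.sq_sqrt ht]
  simp only [lintegral_const, MeasurableSet.univ, Measure.restrict_apply, Set.univ_inter,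
    Real.volume_Ioo]
  rw [← ENNReal.ofReal_mul (by positivity), ← ENNReal.ofReal_mul (by positivity)]
  congr 1
  field_simp
  ring

/-- Multiplying the density of N(0,1) by exp(x²/4) gives √2 times the density of N(0,2). This is the
price of one extra coordinate in `gaussVec_add_two_sq_tail_le`. -/
lemma lintegral_exp_sq_div_four_gaussian :
    ∫⁻ x, ENNReal.ofReal (Real.exp (x ^ 2 / 4)) ∂(gaussianReal 0 1) = ENNReal.ofReal (√2) := by
  rw [gaussianReal_of_var_ne_zero _ one_ne_zero,
    lintegral_withDensity_eq_lintegral_mul _ (measurable_gaussianPDF 0 1) (by fun_prop)]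
  have h : ∀ x : ℝ, (gaussianPDF 0 1 * fun x => ENNReal.ofReal (Real.exp (x ^ 2 / 4))) x =
      ENNReal.ofReal (√2) * gaussianPDF 0 2 x := by
    intro x
    simp only [Pi.mul_apply, gaussianPDF]
    rw [← ENNReal.ofReal_mul (gaussianPDFReal_nonneg _ _ _), ← ENNReal.ofReal_mul (by positivity)]
    congr 1
    simp only [gaussianPDFReal, NNReal.coe_one, mul_one, sub_zero, NNReal.coe_ofNat]
    rw [mul_assoc, ← Real.exp_add, ← mul_assoc,
      show 2 * Real.pi * 2 = 2 * (2 * Real.pi) by ring, Real.sqrt_mul two_pos.le (2 * Real.pi)]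
    congr 1
    · field_simp
    · congr 1; ring
  simp_rw [h]
  rw [lintegral_const_mul _ (measurable_gaussianPDF 0 2),
    lintegral_gaussianPDF_eq_one 0 two_ne_zero, mul_one]

/-- The law of a standard Gaussian vector in `ℝ^d`. -/
noncomputable def gaussVec (d : ℕ) : Measure (Fin d → ℝ) :=
  Measure.pi fun _ => gaussianReal 0 1

instance (d : ℕ) : IsProbabilityMeasure (gaussVec d) := by
  unfold gaussVec; infer_instance

lemma gaussVec_succ_sq_tail (d : ℕ) (t : ℝ) :
    gaussVec (d + 1) {x | t < ∑ i, x i ^ 2} =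
      ∫⁻ a, gaussVec d {x | t - a ^ 2 < ∑ i, x i ^ 2} ∂(gaussianReal 0 1) := by
  have hmp := measurePreserving_piFinSuccAbove (fun _ : Fin (d + 1) => gaussianReal 0 1) 0
  have hms : MeasurableSet {p : ℝ × (Fin d → ℝ) | t < p.1 ^ 2 + ∑ i, p.2 i ^ 2} :=
    measurableSet_lt measurable_const (by fun_prop)
  have h1 := hmp.measure_preimage hms.nullMeasurableSet
  rw [Measure.prod_apply hms] at h1
  have h2 : {x : Fin (d + 1) → ℝ | t < ∑ i, x i ^ 2} =
      (MeasurableEquiv.piFinSuccAbove (fun _ => ℝ) 0) ⁻¹'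
        {p : ℝ × (Fin d → ℝ) | t < p.1 ^ 2 + ∑ i, p.2 i ^ 2} := by
    ext x
    simp [Fin.sum_univ_succ, MeasurableEquiv.piFinSuccAbove, Fin.insertNthEquiv, Fin.tail]
  rw [gaussVec, h2, h1]
  refine lintegral_congr fun a => ?_
  congr 1
  ext x
  simp [sub_lt_iff_lt_add']

lemma gaussVec_two_sq_tail {t : ℝ} (ht : 0 ≤ t) :
    gaussVec 2 {x | t < ∑ i, x i ^ 2} = ENNReal.ofReal (Real.exp (-t / 2)) := by
  have hms : MeasurableSet {p : ℝ × ℝ | t < p.1 ^ 2 + p.2 ^ 2} :=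
    measurableSet_lt measurable_const (by fun_prop)
  have h1 := (measurePreserving_finTwoArrow (gaussianReal 0 1)).measure_preimage
    hms.nullMeasurableSet
  rw [gaussian_prod_sq_tail ht] at h1
  rw [← h1, gaussVec]
  congr 1
  ext x
  simp [MeasurableEquiv.finTwoArrow, Fin.sum_univ_two]

lemma gaussVec_one_sq_tail_le (t : ℝ) :
    gaussVec 1 {x | t < ∑ i, x i ^ 2} ≤ gaussVec 2 {x | t < ∑ i, x i ^ 2} := by
  rw [gaussVec_succ_sq_tail 1]
  calc gaussVec 1 {x | t < ∑ i, x i ^ 2}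
      = ∫⁻ _, gaussVec 1 {x | t < ∑ i, x i ^ 2} ∂(gaussianReal 0 1) := by simp
    _ ≤ _ := lintegral_mono fun a => measure_mono fun x (hx : t < _) =>
        show t - a ^ 2 < _ by nlinarith [sq_nonneg a]

/-- Fixing a new coordinate a replaces t by t - a², which costs the factor E exp(a²/4) = √2. The
rate 1/4 is used because exp(a²/2) would not be integrable. Since t - a² can be negative, the
induction needs every real t; for t ≤ 0 the bound is at least 1. -/
lemma gaussVec_add_two_sq_tail_le (m : ℕ) (t : ℝ) :
    gaussVec (m + 2) {x | t < ∑ i, x i ^ 2} ≤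
      ENNReal.ofReal (√2 ^ m * Real.exp (-t / 4)) := by
  induction m generalizing t with
  | zero =>
    rcases le_total 0 t with ht | ht
    · rw [gaussVec_two_sq_tail ht]
      exact ENNReal.ofReal_le_ofReal (by simp; linarith)
    · refine prob_le_one.trans ?_
      rw [← ENNReal.ofReal_one]
      exact ENNReal.ofReal_le_ofReal (by simp; linarith)
  | succ m ih =>
    rw [show m + 1 + 2 = (m + 2) + 1 by ring, gaussVec_succ_sq_tail]
    calc _ ≤ ∫⁻ a, ENNReal.ofReal (√2 ^ m * Real.exp (-t / 4)) *
            ENNReal.ofReal (Real.exp (a ^ 2 / 4)) ∂(gaussianReal 0 1) := by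
          refine lintegral_mono fun a => (ih _).trans (le_of_eq ?_)
          rw [← ENNReal.ofReal_mul (by positivity), mul_assoc, ← Real.exp_add]
          congr 3; ring
      _ = _ := by
          rw [lintegral_const_mul _ (by fun_prop), lintegral_exp_sq_div_four_gaussian,
            ← ENNReal.ofReal_mul (by positivity)]
          congr 1; ring

/-- A standard Gaussian vector in `ℝ^d` has norm at most `√(2d) L` up to probability `exp (-L)`. -/
lemma gaussVec_norm_tail {d : ℕ} (hd : 0 < d) {L : ℝ} (hL : 1 ≤ L) :
    gaussVec d {x | √(2 * d) * L < ‖(WithLp.toLp 2 x : Vec d)‖} ≤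
      ENNReal.ofReal (Real.exp (-L)) := by
  have hset : {x : Fin d → ℝ | √(2 * d) * L < ‖(WithLp.toLp 2 x : Vec d)‖} =
      {x | 2 * d * L ^ 2 < ∑ i, x i ^ 2} := by
    ext x
    have h0 : 0 ≤ √(2 * d) * L := by positivity
    simp only [Set.mem_ofPred_eq]
    rw [← pow_lt_pow_iff_left₀ h0 (norm_nonneg _) two_ne_zero, EuclideanSpace.real_norm_sq_eq,
      mul_pow, Real.sq_sqrt (by positivity)]
  rw [hset]
  have hLL : L ≤ L ^ 2 := by nlinarith
  obtain _ | _ | m := d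
  · omega
  · refine (gaussVec_one_sq_tail_le _).trans ?_
    rw [gaussVec_two_sq_tail (by positivity)]
    refine ENNReal.ofReal_le_ofReal (Real.exp_le_exp.2 ?_)
    push_cast; linarith
  -- Here d = m + 2, and √2 ≤ exp(1/2) leaves the exponent m/2 - (m + 2)L²/2, which is at most -L² ≤
  -- -L because L ≥ 1.
  · refine (gaussVec_add_two_sq_tail_le m _).trans (ENNReal.ofReal_le_ofReal ?_)
    have h2 : √2 ≤ Real.exp (1 / 2) := by
      rw [Real.sqrt_le_left (Real.exp_nonneg _), ← Real.exp_nat_mul]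
      have := Real.add_one_le_exp (1 : ℝ)
      norm_num
      linarith
    calc √2 ^ m * Real.exp (-(2 * ((m + 1 + 1 : ℕ) : ℝ) * L ^ 2) / 4)
        ≤ Real.exp (1 / 2) ^ m * Real.exp (-(2 * ((m + 1 + 1 : ℕ) : ℝ) * L ^ 2) / 4) := by
          gcongr
      _ = Real.exp (m * (1 / 2) + -(2 * ((m + 1 + 1 : ℕ) : ℝ) * L ^ 2) / 4) := by
          rw [← Real.exp_nat_mul, ← Real.exp_add]
      _ ≤ _ := by
          refine Real.exp_le_exp.2 ?_
          have hm : (0 : ℝ) ≤ m := by positivity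
          push_cast
          nlinarith [mul_nonneg hm (show 0 ≤ L ^ 2 - 1 by nlinarith)]

/-! ### Tail of the norm of a Gaussian Wigner matrix -/

lemma integral_exp_sum_gaussVec {d : ℕ} (a : Fin d → ℝ) :
    ∫ x, Real.exp (∑ j, a j * x j) ∂(Measure.pi fun _ : Fin d => gaussianReal 0 1) =
      Real.exp ((∑ j, a j ^ 2) / 2) := by
  simp_rw [Real.exp_sum]
  rw [integral_fintype_prod_eq_prod (fun j x => Real.exp (a j * x))]
  rw [Finset.sum_div, Real.exp_sum]
  refine Finset.prod_congr rfl fun j _ => ?_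
  have h := congrFun (mgf_fun_id_gaussianReal (μ := 0) (v := 1)) (a j)
  simpa [mgf] using h

lemma integral_exp_sum_gaussArray {d : ℕ} (a : Fin d → Fin d → ℝ) :
    ∫ e, Real.exp (∑ i, ∑ j, a i j * e i j) ∂(gaussArray d) =
      Real.exp ((∑ i, ∑ j, a i j ^ 2) / 2) := by
  simp_rw [Real.exp_sum (s := Finset.univ) (f := fun i => ∑ j, a i j * _)]
  rw [gaussArray, integral_fintype_prod_eq_prod (E := fun _ : Fin d => Fin d → ℝ)
      (fun i x => Real.exp (∑ j, a i j * x j)),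
    Finset.sum_div, Real.exp_sum]
  exact Finset.prod_congr rfl fun i _ => integral_exp_sum_gaussVec (a i)

lemma gaussArray_linear_tail {d : ℕ} (a : Fin d → Fin d → ℝ) (ha : ∑ i, ∑ j, a i j ^ 2 ≤ 2)
    {t : ℝ} (ht : 0 ≤ t) :
    (gaussArray d).real {e | t ≤ ∑ i, ∑ j, a i j * e i j} ≤ Real.exp (-t ^ 2 / 4) := by
  have hmgf : ∫ e, Real.exp (t / 2 * ∑ i, ∑ j, a i j * e i j) ∂(gaussArray d) =
      Real.exp ((∑ i, ∑ j, (t / 2 * a i j) ^ 2) / 2) := by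
    rw [← integral_exp_sum_gaussArray]
    simp_rw [Finset.mul_sum, mul_assoc]
  have hint : Integrable (fun e => Real.exp (t / 2 * ∑ i, ∑ j, a i j * e i j))
      (gaussArray d) := by
    by_contra h
    rw [integral_undef h] at hmgf
    exact (Real.exp_pos _).ne hmgf
  -- Chernoff's bound at t/2, the optimal parameter for variance 2.
  refine (measure_ge_le_exp_mul_mgf t (by positivity : 0 ≤ t / 2) hint).trans ?_
  rw [mgf, hmgf, ← Real.exp_add]
  refine Real.exp_le_exp.2 ?_
  simp_rw [mul_pow, ← Finset.mul_sum]
  nlinarith [sq_nonneg t]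

/-- The coefficients of the linear form `e ↦ ⟪y, symMat e x⟫`. -/
def symCoeff {d : ℕ} (x y : Fin d → ℝ) (i j : Fin d) : ℝ :=
  (if i ≤ j then y i * x j else 0) + (if i < j then y j * x i else 0)

lemma inner_symMat {d : ℕ} (e : Fin d → Fin d → ℝ) (x y : Vec d) :
    inner ℝ y (Matrix.toEuclideanCLM (n := Fin d) (𝕜 := ℝ) (symMat e) x) =
      ∑ i, ∑ j, symCoeff x y i j * e i j := by
  have h1 : inner ℝ y (Matrix.toEuclideanCLM (n := Fin d) (𝕜 := ℝ) (symMat e) x) =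
      ∑ i, ∑ j, y i * x j * symMat e i j := by
    rw [PiLp.inner_apply]
    refine Finset.sum_congr rfl fun i _ => ?_
    rw [Matrix.ofLp_toEuclideanCLM, Matrix.mulVec, dotProduct]
    simp only [RCLike.inner_apply, conj_trivial, Finset.sum_mul]
    exact Finset.sum_congr rfl fun j _ => by ring
  have h2 : ∑ i, ∑ j, (if i < j then y j * x i else 0) * e i j =
      ∑ i, ∑ j, (if j < i then y i * x j else 0) * e j i := Finset.sum_comm
  simp_rw [symCoeff, add_mul, Finset.sum_add_distrib]
  rw [h1, h2, ← Finset.sum_add_distrib]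
  refine Finset.sum_congr rfl fun i _ => ?_
  rw [← Finset.sum_add_distrib]
  refine Finset.sum_congr rfl fun j _ => ?_
  rcases le_or_gt i j with h | h
  · simp [symMat, h, not_lt.2 h]
  · simp [symMat, h, not_le.2 h]

/-- An entry above the diagonal occurs twice in the symmetric matrix and has coefficient y i * x j +
y j * x i; (a + b)² ≤ 2a² + 2b² then costs the factor 2. For unit vectors the linear form has
variance at most 2. -/
lemma sum_symCoeff_sq_le {d : ℕ} (x y : Vec d) :
    ∑ i, ∑ j, symCoeff x y i j ^ 2 ≤ 2 * (‖x‖ ^ 2 * ‖y‖ ^ 2) := by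
  have hle : ∀ i j, symCoeff x y i j ^ 2 ≤
      2 * (if i ≤ j then y i ^ 2 * x j ^ 2 else 0) +
      2 * (if i < j then y j ^ 2 * x i ^ 2 else 0) := by
    intro i j
    unfold symCoeff
    split_ifs <;> nlinarith [sq_nonneg (y i * x j - y j * x i), sq_nonneg (y i * x j)]
  have h2 : ∑ i, ∑ j, 2 * (if i < j then y j ^ 2 * x i ^ 2 else 0) =
      ∑ i, ∑ j, 2 * (if j < i then y i ^ 2 * x j ^ 2 else 0) := Finset.sum_comm
  calc _ ≤ ∑ i, ∑ j, (2 * (if i ≤ j then y i ^ 2 * x j ^ 2 else 0) +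
      2 * (if i < j then y j ^ 2 * x i ^ 2 else 0)) :=
        Finset.sum_le_sum fun i _ => Finset.sum_le_sum fun j _ => hle i j
    _ = ∑ i, ∑ j, 2 * (y i ^ 2 * x j ^ 2) := by
        simp_rw [Finset.sum_add_distrib]
        rw [h2, ← Finset.sum_add_distrib]
        refine Finset.sum_congr rfl fun i _ => ?_
        rw [← Finset.sum_add_distrib]
        refine Finset.sum_congr rfl fun j _ => ?_
        rcases le_or_gt i j with h | h
        · simp [h, not_lt.2 h]
        · simp [h, not_le.2 h]
    _ = _ := by
        rw [EuclideanSpace.real_norm_sq_eq, EuclideanSpace.real_norm_sq_eq, mul_comm (∑ i, _),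
          Finset.sum_mul_sum, Finset.mul_sum]
        simp_rw [Finset.mul_sum]

/-- The unit sphere of a finite-dimensional space has a `1/2`-net with at most `5 ^ dim` points. -/
lemma exists_sphere_net (E : Type*) [NormedAddCommGroup E] [NormedSpace ℝ E]
    [FiniteDimensional ℝ E] :
    ∃ N : Finset E, N.card ≤ 5 ^ Module.finrank ℝ E ∧ (∀ v ∈ N, ‖v‖ = 1) ∧
      ∀ u : E, ‖u‖ = 1 → ∃ v ∈ N, ‖u - v‖ ≤ 1 / 2 := by
  classical
  -- Norm 2 and separation 1 is the scale at which the Besicovitch packing bound gives 5 ^ dim.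
  -- Halving a set of maximal size gives the net: a point far from it could be added.
  let P : ℕ → Prop := fun k => ∃ s : Finset E, s.card = k ∧ (∀ c ∈ s, ‖c‖ = 2) ∧
    ∀ c ∈ s, ∀ d ∈ s, c ≠ d → 1 ≤ ‖c - d‖
  have hP0 : P 0 := ⟨∅, by simp⟩
  have hbd : ∀ k, P k → k ≤ 5 ^ Module.finrank ℝ E := by
    rintro k ⟨s, rfl, h1, h2⟩
    exact Besicovitch.card_le_of_separated s (fun c hc => (h1 c hc).le) h2
  obtain ⟨s, hs, h1, h2⟩ := Nat.findGreatest_spec (Nat.zero_le (5 ^ Module.finrank ℝ E)) hP0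
  have hmax : ¬ P (s.card + 1) := fun h => by
    have := Nat.le_findGreatest (hbd _ h) h
    omega
  refine ⟨s.image fun c => (1 / 2 : ℝ) • c, Finset.card_image_le.trans (hbd _ ⟨s, rfl, h1, h2⟩),
    ?_, fun u hu => ?_⟩
  · intro v hv
    obtain ⟨c, hc, rfl⟩ := Finset.mem_image.1 hv
    rw [norm_smul, h1 c hc]; norm_num
  · by_contra! hfar
    have hfar' : ∀ c ∈ s, 1 < ‖(2 : ℝ) • u - c‖ := by
      intro c hc
      have h := hfar _ (Finset.mem_image_of_mem (fun c => (1 / 2 : ℝ) • c) hc)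
      have he : (2 : ℝ) • u - c = (2 : ℝ) • (u - (1 / 2 : ℝ) • c) := by
        rw [smul_sub, smul_smul]; norm_num
      rw [he, norm_smul]
      norm_num at h ⊢
      linarith
    refine hmax ⟨insert ((2 : ℝ) • u) s, ?_, ?_, ?_⟩
    · refine Finset.card_insert_of_notMem fun hmem => ?_
      have := hfar' _ hmem
      norm_num at this
    · intro c hc
      rcases Finset.mem_insert.1 hc with rfl | hc
      · rw [norm_smul, hu]; norm_num
      · exact h1 c hc
    · intro c hc c' hc' hne
      rcases Finset.mem_insert.1 hc with rfl | hc <;> rcases Finset.mem_insert.1 hc' with rfl | hc'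
      · exact absurd rfl hne
      · exact (hfar' c' hc').le
      · rw [norm_sub_rev]; exact (hfar' c hc).le
      · exact h2 c hc c' hc' hne

lemma norm_le_of_net {E : Type*} [NormedAddCommGroup E] [InnerProductSpace ℝ E]
    {N : Finset E} (hN : ∀ u : E, ‖u‖ = 1 → ∃ v ∈ N, ‖u - v‖ ≤ 1 / 2) {z : E} {m : ℝ}
    (hm : 0 ≤ m) (hz : ∀ y ∈ N, inner ℝ y z ≤ m) : ‖z‖ ≤ 2 * m := by
  rcases eq_or_ne z 0 with rfl | hne
  · simpa using hm
  have hpos : 0 < ‖z‖ := norm_pos_iff.2 hne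
  obtain ⟨y, hy, hyu⟩ := hN (‖z‖⁻¹ • z) (by rw [norm_smul]; simp [hpos.ne'])
  have h1 : inner ℝ (‖z‖⁻¹ • z) z = ‖z‖ := by
    rw [real_inner_smul_left, real_inner_self_eq_norm_sq]; field_simp
  have h2 : inner ℝ (‖z‖⁻¹ • z - y) z ≤ 1 / 2 * ‖z‖ :=
    (real_inner_le_norm _ _).trans (by gcongr)
  rw [inner_sub_left, h1] at h2
  linarith [hz y hy]

/-- Replacing a unit vector by a net point at distance at most 1/2 costs a factor 2 in each of the
two arguments of the bilinear form. -/
lemma opNorm_le_of_net {E : Type*} [NormedAddCommGroup E] [InnerProductSpace ℝ E]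
    {N : Finset E} (hN : ∀ u : E, ‖u‖ = 1 → ∃ v ∈ N, ‖u - v‖ ≤ 1 / 2) {A : E →L[ℝ] E} {m : ℝ}
    (hm : 0 ≤ m) (hA : ∀ x ∈ N, ∀ y ∈ N, inner ℝ y (A x) ≤ m) : ‖A‖ ≤ 4 * m := by
  have h : ‖A‖ ≤ 2 * m + 1 / 2 * ‖A‖ := by
    refine ContinuousLinearMap.opNorm_le_of_unit_norm (by positivity) fun u hu => ?_
    obtain ⟨x, hx, hxu⟩ := hN u hu
    have h1 : A u = A x + A (u - x) := by rw [map_sub]; abel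
    have h2 : ‖A (u - x)‖ ≤ 1 / 2 * ‖A‖ := by
      refine (A.le_opNorm _).trans ?_
      rw [mul_comm]; gcongr
    rw [h1]
    exact (norm_add_le _ _).trans (add_le_add (norm_le_of_net hN hm (hA x hx)) h2)
  linarith

/-- Union bound over the at most 5^d · 5^d pairs of net points. The factor 4 lost to the net lowers
the level to A√d/4, whose Chernoff exponent is A²d/64. -/
lemma opNorm_symMat_tail (d : ℕ) {A : ℝ} (hA : 0 ≤ A) :
    (gaussArray d).real {e | A * √d < opNorm (symMat e)} ≤ 25 ^ d * Real.exp (-A ^ 2 * d / 64) := by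
  classical
  obtain ⟨N, hcard, hunit, hnet⟩ := exists_sphere_net (Vec d)
  rw [finrank_euclideanSpace_fin] at hcard
  have hm : 0 ≤ A * √d / 4 := by positivity
  have hsub : {e : Fin d → Fin d → ℝ | A * √d < opNorm (symMat e)} ⊆
      ⋃ p ∈ N ×ˢ N, {e | A * √d / 4 ≤ ∑ i, ∑ j, symCoeff p.1 p.2 i j * e i j} := by
    intro e he
    by_contra hcon
    simp only [Set.mem_iUnion, not_exists, Set.mem_ofPred_eq, not_le] at hcon
    have : opNorm (symMat e) ≤ 4 * (A * √d / 4) := by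
      refine opNorm_le_of_net hnet hm fun x hx y hy => ?_
      rw [inner_symMat]
      exact (hcon (x, y) (Finset.mk_mem_product hx hy)).le
    have he' : A * √d < opNorm (symMat e) := he
    linarith
  calc (gaussArray d).real {e | A * √d < opNorm (symMat e)}
      ≤ (gaussArray d).real (⋃ p ∈ N ×ˢ N,
          {e | A * √d / 4 ≤ ∑ i, ∑ j, symCoeff p.1 p.2 i j * e i j}) :=
        measureReal_mono hsub (measure_ne_top _ _)
    _ ≤ ∑ p ∈ N ×ˢ N, (gaussArray d).real
          {e | A * √d / 4 ≤ ∑ i, ∑ j, symCoeff p.1 p.2 i j * e i j} :=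
        measureReal_biUnion_finset_le _ _
    _ ≤ ∑ p ∈ N ×ˢ N, Real.exp (-A ^ 2 * d / 64) := by
        refine Finset.sum_le_sum fun p hp => ?_
        obtain ⟨h1, h2⟩ := Finset.mem_product.1 hp
        refine (gaussArray_linear_tail _ ?_ hm).trans (le_of_eq ?_)
        · refine (sum_symCoeff_sq_le p.1 p.2).trans ?_
          rw [hunit _ h1, hunit _ h2]; norm_num
        · congr 1
          rw [div_pow, mul_pow, Real.sq_sqrt (by positivity)]; ring
    _ ≤ 25 ^ d * Real.exp (-A ^ 2 * d / 64) := by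
        rw [Finset.sum_const, Finset.card_product, nsmul_eq_mul]
        gcongr
        have : ((N.card * N.card : ℕ) : ℝ) ≤ ((5 ^ d * 5 ^ d : ℕ) : ℝ) := by
          exact_mod_cast Nat.mul_le_mul hcard hcard
        refine this.trans (le_of_eq ?_)
        push_cast
        rw [← mul_pow]; norm_num

lemma wignerTail : WignerTail 128 1 := by
  intro d A hA
  rcases Nat.eq_zero_or_pos d with rfl | hd
  · have : {e : Fin 0 → Fin 0 → ℝ | A * √((0 : ℕ) : ℝ) < opNorm (symMat e)} = ∅ := by
      ext e
      simp [opNorm]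
    rw [this]; simp
  have hd1 : (1 : ℝ) ≤ d := by exact_mod_cast hd
  rw [← ofReal_measureReal]
  refine ENNReal.ofReal_le_ofReal ((opNorm_symMat_tail d (by linarith)).trans ?_)
  have h25 : (25 : ℝ) ≤ Real.exp 4 := by
    have h := Real.exp_one_gt_d9
    have : Real.exp 4 = Real.exp 1 ^ 4 := by rw [← Real.exp_nat_mul]; norm_num
    rw [this]
    calc (25 : ℝ) ≤ 2.7 ^ 4 := by norm_num
      _ ≤ _ := by gcongr; linarith
  calc (25 : ℝ) ^ d * Real.exp (-A ^ 2 * d / 64)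
      ≤ Real.exp 4 ^ d * Real.exp (-A ^ 2 * d / 64) := by gcongr
    _ = Real.exp (d * 4 + -A ^ 2 * d / 64) := by rw [← Real.exp_nat_mul, ← Real.exp_add]
    _ ≤ Real.exp (-1 * A * d) := by
        -- A ≥ 128 gives A²/64 ≥ 2A and 4 ≤ A.
        refine Real.exp_le_exp.2 ?_
        nlinarith [mul_nonneg (show 0 ≤ A ^ 2 - 128 * A by nlinarith) (show (0 : ℝ) ≤ d by linarith),
          mul_nonneg (show 0 ≤ A - 128 by linarith) (show (0 : ℝ) ≤ d by linarith)]
    _ ≤ 128 * Real.exp (-1 * A * d) := by linarith [Real.exp_pos (-1 * A * d)]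

/-! ### The good event for the noise -/

lemma laplaceStd_Ioi {b : ℝ} (hb : 0 ≤ b) :
    laplaceStd (Set.Ioi b) = ENNReal.ofReal (Real.exp (-b) / 2) := by
  have h : ∀ x ∈ Set.Ioi b, ENNReal.ofReal (Real.exp (-|x|) / 2) =
      ENNReal.ofReal (Real.exp (-x) / 2) := fun x hx => by
    rw [abs_of_pos (hb.trans_lt hx)]
  rw [laplaceStd, withDensity_apply _ measurableSet_Ioi,
    setLIntegral_congr_fun measurableSet_Ioi h,
    ← ofReal_integral_eq_lintegral_ofReal ((integrableOn_exp_neg_Ioi b).div_const 2)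
      (Filter.Eventually.of_forall fun x => by positivity), integral_div, integral_exp_neg_Ioi]

lemma laplaceStd_Iio_neg {a : ℝ} (ha : 0 ≤ a) :
    laplaceStd (Set.Iio (-a)) = ENNReal.ofReal (Real.exp (-a) / 2) := by
  have h : ∀ x ∈ Set.Iio (-a), ENNReal.ofReal (Real.exp (-|x|) / 2) =
      ENNReal.ofReal (Real.exp x / 2) := fun x hx => by
    have hx : x < -a := hx
    rw [abs_of_neg (by linarith), neg_neg]
  rw [laplaceStd, withDensity_apply _ measurableSet_Iio,
    setLIntegral_congr_fun measurableSet_Iio h,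
    ← ofReal_integral_eq_lintegral_ofReal
      (((integrableOn_exp_Iic (-a)).mono_set Set.Iio_subset_Iic_self).div_const 2)
      (Filter.Eventually.of_forall fun x => by positivity), integral_div,
    ← integral_Iic_eq_integral_Iio, integral_exp_Iic]

lemma ofReal_one_sub_le_of_compl_le {Ω : Type*} [MeasurableSpace Ω] {μ : Measure Ω}
    [IsProbabilityMeasure μ] {s : Set Ω} (hs : MeasurableSet s) {p : ℝ} (hp : 0 ≤ p)
    (h : μ sᶜ ≤ ENNReal.ofReal p) : ENNReal.ofReal (1 - p) ≤ μ s := by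
  rw [ENNReal.ofReal_sub _ hp, ENNReal.ofReal_one, ← compl_compl s, prob_compl_eq_one_sub hs.compl]
  exact tsub_le_tsub_left h 1

/-- Noise for which the perturbed gradient is accurate up to `R`, the perturbed Hessian up to `Q`,
and the first `m` queries of the line search up to `ℓ`, relative to the respective scales. -/
def goodNoise (d : ℕ) (R Q ℓ : ℝ) (m : ℕ) : Set (IterNoise d) :=
  {x | ‖(WithLp.toLp 2 x : Vec d)‖ ≤ R} ×ˢ ({e | opNorm (symMat e) ≤ Q} ×ˢ
    (Set.Ici (-(2 * ℓ)) ×ˢ (Set.pi (Finset.range m) fun _ => Set.Iic ℓ)))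

lemma measurableSet_norm_toLp_le (d : ℕ) (R : ℝ) :
    MeasurableSet {x : Fin d → ℝ | ‖(WithLp.toLp 2 x : Vec d)‖ ≤ R} := by
  refine measurableSet_le ?_ measurable_const
  exact (Continuous.norm (PiLp.continuous_toLp 2 _)).measurable

lemma continuous_opNorm_symMat (d : ℕ) :
    Continuous fun e : Fin d → Fin d → ℝ => opNorm (symMat e) := by
  have h1 : Continuous fun e : Fin d → Fin d → ℝ => symMat e := by
    refine continuous_matrix fun i j => ?_
    by_cases h : i ≤ j
    · simp only [symMat, Matrix.of_apply, h, if_true]; fun_prop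
    · simp only [symMat, Matrix.of_apply, h, if_false]; fun_prop
  have h2 : Continuous fun A : Matrix (Fin d) (Fin d) ℝ =>
      Matrix.toEuclideanCLM (n := Fin d) (𝕜 := ℝ) A :=
    (Matrix.toEuclideanCLM (n := Fin d) (𝕜 := ℝ)).toAlgEquiv.toLinearMap.continuous_of_finiteDimensional
  exact (h2.comp h1).norm

lemma measurableSet_opNorm_symMat_le (d : ℕ) (Q : ℝ) :
    MeasurableSet {e : Fin d → Fin d → ℝ | opNorm (symMat e) ≤ Q} :=
  measurableSet_le (continuous_opNorm_symMat d).measurable measurable_const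

lemma measurableSet_pi_range_Iic (m : ℕ) (ℓ : ℝ) :
    MeasurableSet (Set.pi (Finset.range m) fun _ : ℕ => Set.Iic ℓ) :=
  MeasurableSet.pi (Finset.countable_toSet _) fun _ _ => measurableSet_Iic

lemma measurableSet_goodNoise (d : ℕ) (R Q ℓ : ℝ) (m : ℕ) :
    MeasurableSet (goodNoise d R Q ℓ m) :=
  (measurableSet_norm_toLp_le d R).prod ((measurableSet_opNorm_symMat_le d Q).prod
    (measurableSet_Ici.prod (measurableSet_pi_range_Iic m ℓ)))

/-- The noise of the sparse vector technique with `m` queries is small up to probability `β`. -/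
lemma laplace_line_search_tail {m : ℕ} {ℓ β : ℝ} (hℓ : 0 ≤ ℓ) (hm : 0 < m) (hβ : β ≤ 1)
    (h : m * Real.exp (-ℓ) = β) :
    ENNReal.ofReal (1 - β) ≤
      laplaceStd (Set.Ici (-(2 * ℓ))) * Measure.infinitePi (fun _ : ℕ => laplaceStd)
        (Set.pi (Finset.range m) fun _ => Set.Iic ℓ) := by
  have hm1 : (1 : ℝ) ≤ m := by exact_mod_cast hm
  have he := Real.exp_pos (-ℓ)
  have he1 : Real.exp (-ℓ) ≤ 1 := Real.exp_le_one_iff.2 (by linarith)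
  -- The failure budget β is split evenly. The threshold fails with probability exp(-2ℓ)/2 ≤ β/2,
  -- and by Bernoulli's inequality all m queries are good with probability at least 1 - m exp(-ℓ)/2
  -- = 1 - β/2.
  have h1 : ENNReal.ofReal (1 - β / 2) ≤ laplaceStd (Set.Ici (-(2 * ℓ))) := by
    refine ofReal_one_sub_le_of_compl_le measurableSet_Ici (by nlinarith) ?_
    rw [Set.compl_Ici, laplaceStd_Iio_neg (by linarith)]
    refine ENNReal.ofReal_le_ofReal ?_
    have : Real.exp (-(2 * ℓ)) ≤ Real.exp (-ℓ) := Real.exp_le_exp.2 (by linarith)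
    nlinarith
  have h2 : ENNReal.ofReal (1 - β / 2) ≤ Measure.infinitePi (fun _ : ℕ => laplaceStd)
        (Set.pi (Finset.range m) fun _ => Set.Iic ℓ) := by
    have h3 : ENNReal.ofReal (1 - Real.exp (-ℓ) / 2) ≤ laplaceStd (Set.Iic ℓ) := by
      refine ofReal_one_sub_le_of_compl_le measurableSet_Iic (by linarith) ?_
      rw [Set.compl_Iic, laplaceStd_Ioi hℓ]
    rw [Measure.infinitePi_pi _ (fun _ _ => measurableSet_Iic), Finset.prod_const,
      Finset.card_range]
    refine le_trans ?_ (pow_le_pow_left' h3 m)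
    rw [← ENNReal.ofReal_pow (by linarith)]
    refine ENNReal.ofReal_le_ofReal ?_
    have := one_add_mul_le_pow (a := -(Real.exp (-ℓ) / 2)) (by linarith) m
    rw [← sub_eq_add_neg] at this
    refine le_trans (le_of_eq ?_) this
    rw [← h]; ring
  refine le_trans ?_ (mul_le_mul' h1 h2)
  rw [← ENNReal.ofReal_mul (by linarith)]
  exact ENNReal.ofReal_le_ofReal (by nlinarith [sq_nonneg β])

lemma le_iterNoiseLaw_goodNoise {C C₁ : ℝ} (hW : WignerTail C C₁) (hC : 0 ≤ C) {d : ℕ}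
    (hd : 0 < d) (hCd : C * Real.exp (-C₁ * C * d) ≤ 1) {L ℓ β : ℝ} {m : ℕ} (hL : 1 ≤ L)
    (hℓ : 0 ≤ ℓ) (hm : 0 < m) (hβ : β ≤ 1) (h : m * Real.exp (-ℓ) = β) :
    ENNReal.ofReal ((1 - Real.exp (-L)) * (1 - C * Real.exp (-C₁ * C * d)) * (1 - β)) ≤
      iterNoiseLaw d (goodNoise d (√(2 * d) * L) (C * √d) ℓ m) := by
  have h1 : ENNReal.ofReal (1 - Real.exp (-L)) ≤
      gaussVec d {x | ‖(WithLp.toLp 2 x : Vec d)‖ ≤ √(2 * d) * L} := by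
    refine ofReal_one_sub_le_of_compl_le (measurableSet_norm_toLp_le _ _) (Real.exp_nonneg _) ?_
    convert gaussVec_norm_tail hd hL using 2
    ext x; simp
  have h2 : ENNReal.ofReal (1 - C * Real.exp (-C₁ * C * d)) ≤
      gaussArray d {e | opNorm (symMat e) ≤ C * √d} := by
    refine ofReal_one_sub_le_of_compl_le (measurableSet_opNorm_symMat_le _ _) (by positivity) ?_
    convert hW d C le_rfl using 2
    ext x; simp
  have he : Real.exp (-L) ≤ 1 := Real.exp_le_one_iff.2 (by linarith)
  rw [goodNoise, iterNoiseLaw, Measure.prod_prod, Measure.prod_prod, Measure.prod_prod, mul_assoc,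
    ENNReal.ofReal_mul (by linarith), ENNReal.ofReal_mul (by linarith)]
  exact mul_le_mul' h1 (mul_le_mul' h2 (laplace_line_search_tail hℓ hm hβ h))

lemma noiseLaw_pi_range (d T : ℕ) {s : Set (IterNoise d)} (hs : MeasurableSet s) :
    noiseLaw d (Set.pi (Finset.range T) fun _ => s) = iterNoiseLaw d s ^ T := by
  rw [noiseLaw, Measure.infinitePi_pi _ (fun _ _ => hs), Finset.prod_const, Finset.card_range]

/-! ### Second-order calculus -/

lemma differentiable_gradient {d : ℕ} {f : Vec d → ℝ} (hf : ContDiff ℝ 2 f) :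
    Differentiable ℝ (gradient f) := by
  rw [differentiable_euclidean]
  intro i
  have h : (fun x => gradient f x i) = fun x => fderiv ℝ f x (EuclideanSpace.single i 1) := by
    ext x
    rw [← inner_gradient_left, EuclideanSpace.inner_single_right]
    simp
  rw [h]
  exact ((hf.fderiv_right (m := 1) (by norm_num)).differentiable one_ne_zero).clm_apply
    (differentiable_const _)

lemma toEuclideanCLM_hessian {d : ℕ} (f : Vec d → ℝ) (w : Vec d) :
    Matrix.toEuclideanCLM (n := Fin d) (𝕜 := ℝ) (hessian f w) = fderiv ℝ (gradient f) w := by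
  rw [hessian, StarAlgEquiv.apply_symm_apply]

/-- Both sides are the derivative along u of ⟪∇f, v⟫ = Df v. This carries Schwarz's symmetry of
second derivatives over to the Hessian matrix. -/
lemma inner_fderiv_gradient {d : ℕ} {f : Vec d → ℝ} (hf : ContDiff ℝ 2 f) (w u v : Vec d) :
    inner ℝ (fderiv ℝ (gradient f) w u) v = fderiv ℝ (fderiv ℝ f) w u v := by
  have h1 := ((differentiable_gradient hf w).hasFDerivAt.inner ℝ (hasFDerivAt_const v w)).fderiv
  have h2 := (((hf.fderiv_right (m := 1) (by norm_num)).differentiable one_ne_zero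
    w).hasFDerivAt.clm_apply (hasFDerivAt_const v w)).fderiv
  simp only [inner_gradient_left] at h1
  rw [h1] at h2
  simpa using congrArg (fun A : Vec d →L[ℝ] ℝ => A u) h2

lemma isSymm_hessian {d : ℕ} {f : Vec d → ℝ} (hf : ContDiff ℝ 2 f) (w : Vec d) :
    (hessian f w).IsSymm := by
  have hentry : ∀ i j, hessian f w i j =
      fderiv ℝ (fderiv ℝ f) w (EuclideanSpace.single j 1) (EuclideanSpace.single i 1) := by
    intro i j
    rw [← inner_fderiv_gradient hf, ← toEuclideanCLM_hessian, real_inner_comm,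
      Matrix.inner_toEuclideanCLM]
    simp
  ext i j
  rw [Matrix.transpose_apply, hentry, hentry]
  exact hf.contDiffAt.isSymmSndFDerivAt (by simp) _ _

lemma le_of_hasDerivAt_nonpos {g g' : ℝ → ℝ} (hg : ∀ t, HasDerivAt g (g' t) t)
    (hg' : ∀ t, 0 ≤ t → g' t ≤ 0) {t : ℝ} (ht : 0 ≤ t) : g t ≤ g 0 := by
  have hanti : AntitoneOn g (Set.Ici 0) := by
    refine antitoneOn_of_deriv_nonpos (convex_Ici 0)
      (fun x _ => (hg x).continuousAt.continuousWithinAt)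
      (fun x _ => (hg x).differentiableAt.differentiableWithinAt) fun x hx => ?_
    rw [(hg x).deriv]
    exact hg' x (interior_subset hx)
  exact hanti Set.self_mem_Ici ht ht

lemma hasDerivAt_comp_line {E F : Type*} [NormedAddCommGroup E] [NormedSpace ℝ E]
    [NormedAddCommGroup F] [NormedSpace ℝ F] {f : E → F} (hf : Differentiable ℝ f) (w v : E)
    (t : ℝ) : HasDerivAt (fun s : ℝ => f (w + s • v)) (fderiv ℝ f (w + t • v) v) t := by
  have h : HasDerivAt (fun s : ℝ => w + s • v) v t := by
    simpa using ((hasDerivAt_id t).smul_const v).const_add w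
  exact (hf _).hasFDerivAt.comp_hasDerivAt t h

/-- The descent lemma for functions with Lipschitz gradient. -/
lemma le_quadratic_of_gradient_lipschitz {d : ℕ} {f : Vec d → ℝ} (hf : ContDiff ℝ 2 f) {G : ℝ}
    (hG : ∀ w₁ w₂, ‖gradient f w₁ - gradient f w₂‖ ≤ G * ‖w₁ - w₂‖) (w v : Vec d) :
    f (w + v) ≤ f w + inner ℝ (gradient f w) v + G / 2 * ‖v‖ ^ 2 := by
  -- Along the segment, f minus its quadratic majorant has nonpositive derivative for t ≥ 0, by
  -- Cauchy–Schwarz and the Lipschitz bound. Comparing t = 1 with t = 0 gives the claim.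
  have hd : ∀ t : ℝ, HasDerivAt
      (fun s : ℝ => f (w + s • v) - s * inner ℝ (gradient f w) v - s ^ 2 * (G / 2 * ‖v‖ ^ 2))
      (inner ℝ (gradient f (w + t • v) - gradient f w) v - G * t * ‖v‖ ^ 2) t := by
    intro t
    have h1 := hasDerivAt_comp_line (hf.differentiable two_ne_zero) w v t
    have h2 := (hasDerivAt_id' t).mul_const (inner ℝ (gradient f w) v)
    have h3 := (hasDerivAt_pow 2 t).mul_const (G / 2 * ‖v‖ ^ 2)
    refine ((h1.sub h2).sub h3).congr_deriv ?_
    rw [inner_sub_left, inner_gradient_left]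
    norm_num
    ring
  have h := le_of_hasDerivAt_nonpos hd (fun t ht => ?_) zero_le_one
  · simp only [one_smul, zero_smul, add_zero] at h
    linarith
  · have h1 := real_inner_le_norm (gradient f (w + t • v) - gradient f w) v
    have h2 := hG (w + t • v) w
    rw [add_sub_cancel_left, norm_smul, Real.norm_of_nonneg ht] at h2
    nlinarith [mul_le_mul_of_nonneg_right h2 (norm_nonneg v)]

/-- The descent lemma for functions with Lipschitz Hessian. -/
lemma le_cubic_of_hessian_lipschitz {d : ℕ} {f : Vec d → ℝ} (hf : ContDiff ℝ 2 f) {M : ℝ}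
    (hM : ∀ w₁ w₂, ‖fderiv ℝ (gradient f) w₁ - fderiv ℝ (gradient f) w₂‖ ≤ M * ‖w₁ - w₂‖)
    (w v : Vec d) :
    f (w + v) ≤ f w + inner ℝ (gradient f w) v + inner ℝ (fderiv ℝ (gradient f) w v) v / 2 +
      M / 6 * ‖v‖ ^ 3 := by
  -- The comparison is made twice: first for the gradient along the line, whose outcome `hle1` is
  -- then the sign of the derivative in `hd2`.
  have hd1 : ∀ t : ℝ, HasDerivAt
      (fun s : ℝ => inner ℝ (gradient f (w + s • v) - gradient f w) v -
        s * inner ℝ (fderiv ℝ (gradient f) w v) v - s ^ 2 * (M / 2 * ‖v‖ ^ 3))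
      (inner ℝ ((fderiv ℝ (gradient f) (w + t • v) - fderiv ℝ (gradient f) w) v) v -
        M * t * ‖v‖ ^ 3) t := by
    intro t
    have h1 := ((hasDerivAt_comp_line (differentiable_gradient hf) w v t).sub_const
      (gradient f w)).inner ℝ (hasDerivAt_const t v)
    have h2 := (hasDerivAt_id' t).mul_const (inner ℝ (fderiv ℝ (gradient f) w v) v)
    have h3 := (hasDerivAt_pow 2 t).mul_const (M / 2 * ‖v‖ ^ 3)
    refine ((h1.sub h2).sub h3).congr_deriv ?_
    rw [sub_apply, inner_sub_left (fderiv ℝ (gradient f) (w + t • v) v), inner_zero_right]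
    norm_num
    ring
  have hle1 : ∀ t : ℝ, 0 ≤ t → inner ℝ (gradient f (w + t • v) - gradient f w) v -
        t * inner ℝ (fderiv ℝ (gradient f) w v) v - t ^ 2 * (M / 2 * ‖v‖ ^ 3) ≤ 0 := by
    intro t ht
    refine (le_of_hasDerivAt_nonpos hd1 (fun t ht => ?_) ht).trans (by simp)
    have h1 := real_inner_le_norm
      ((fderiv ℝ (gradient f) (w + t • v) - fderiv ℝ (gradient f) w) v) v
    have h2 := hM (w + t • v) w
    rw [add_sub_cancel_left, norm_smul, Real.norm_of_nonneg ht] at h2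
    have h3 := (fderiv ℝ (gradient f) (w + t • v) - fderiv ℝ (gradient f) w).le_opNorm v
    have h4 := mul_le_mul_of_nonneg_right (h3.trans (mul_le_mul_of_nonneg_right h2
      (norm_nonneg v))) (norm_nonneg v)
    nlinarith
  have hd2 : ∀ t : ℝ, HasDerivAt
      (fun s : ℝ => f (w + s • v) - s * inner ℝ (gradient f w) v -
        s ^ 2 * (inner ℝ (fderiv ℝ (gradient f) w v) v / 2) - s ^ 3 * (M / 6 * ‖v‖ ^ 3))
      (inner ℝ (gradient f (w + t • v) - gradient f w) v -
        t * inner ℝ (fderiv ℝ (gradient f) w v) v - t ^ 2 * (M / 2 * ‖v‖ ^ 3)) t := by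
    intro t
    have h1 := hasDerivAt_comp_line (hf.differentiable two_ne_zero) w v t
    have h2 := (hasDerivAt_id' t).mul_const (inner ℝ (gradient f w) v)
    have h3 := (hasDerivAt_pow 2 t).mul_const (inner ℝ (fderiv ℝ (gradient f) w v) v / 2)
    have h4 := (hasDerivAt_pow 3 t).mul_const (M / 6 * ‖v‖ ^ 3)
    refine (((h1.sub h2).sub h3).sub h4).congr_deriv ?_
    rw [inner_sub_left, inner_gradient_left]
    norm_num
    ring
  have h := le_of_hasDerivAt_nonpos hd2 hle1 zero_le_one
  simp only [one_smul, zero_smul, add_zero] at h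
  linarith

/-! ### The smallest eigenvalue -/

/-- Subtracting `minEig A` times the identity makes the spectrum nonnegative, hence the symmetric
matrix positive semidefinite. -/
lemma minEig_mul_norm_sq_le {d : ℕ} {A : Matrix (Fin d) (Fin d) ℝ} (hA : A.IsSymm) (v : Vec d) :
    minEig A * ‖v‖ ^ 2 ≤ inner ℝ v (Matrix.toEuclideanCLM (n := Fin d) (𝕜 := ℝ) A v) := by
  have hH : A.IsHermitian := by
    rw [Matrix.IsHermitian, Matrix.conjTranspose_eq_transpose_of_trivial]; exact hA
  have hpsd : (A - algebraMap ℝ _ (minEig A)).PosSemidef := by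
    rw [Matrix.posSemidef_iff_isHermitian_and_spectrum_nonneg]
    refine ⟨hH.sub ?_, fun x hx => ?_⟩
    · rw [Matrix.IsHermitian, Matrix.conjTranspose_eq_transpose_of_trivial,
        Matrix.algebraMap_eq_diagonal, Matrix.diagonal_transpose]
    · rw [← spectrum.sub_singleton_eq, Set.sub_singleton] at hx
      obtain ⟨y, hy, rfl⟩ := hx
      exact sub_nonneg.2 (csInf_le A.finite_real_spectrum.bddBelow hy)
  have h := hpsd.dotProduct_mulVec_nonneg v.ofLp
  rw [star_trivial, ← Matrix.inner_toEuclideanCLM, map_sub, sub_apply,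
    inner_sub_right] at h
  have h2 : Matrix.toEuclideanCLM (n := Fin d) (𝕜 := ℝ) (algebraMap ℝ _ (minEig A)) v =
      minEig A • v := by
    rw [Algebra.algebraMap_eq_smul_one, map_smul, map_one]; rfl
  rw [h2, real_inner_smul_right, real_inner_self_eq_norm_sq] at h
  linarith

lemma le_minEig {d : ℕ} (hd : 0 < d) {A : Matrix (Fin d) (Fin d) ℝ} (hA : A.IsSymm) {c : ℝ}
    (h : ∀ v : Vec d, ‖v‖ = 1 →
      c ≤ inner ℝ v (Matrix.toEuclideanCLM (n := Fin d) (𝕜 := ℝ) A v)) : c ≤ minEig A := by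
  have hH : A.IsHermitian := by
    rw [Matrix.IsHermitian, Matrix.conjTranspose_eq_transpose_of_trivial]; exact hA
  -- In dimension 0 the spectrum is empty and its infimum takes the default value 0.
  have : Nonempty (Fin d) := ⟨⟨0, hd⟩⟩
  rw [minEig, hH.spectrum_real_eq_range_eigenvalues]
  refine le_csInf (Set.range_nonempty _) ?_
  rintro _ ⟨i, rfl⟩
  have hn : ‖hH.eigenvectorBasis i‖ = 1 := hH.eigenvectorBasis.orthonormal.1 i
  have h1 := h _ hn
  have h2 : Matrix.toEuclideanCLM (n := Fin d) (𝕜 := ℝ) A (hH.eigenvectorBasis i) =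
      hH.eigenvalues i • hH.eigenvectorBasis i := by
    apply WithLp.ofLp_injective
    rw [Matrix.ofLp_toEuclideanCLM, hH.mulVec_eigenvectorBasis]
    rfl
  rwa [h2, real_inner_smul_right, real_inner_self_eq_norm_sq, hn, one_pow, mul_one] at h1

lemma abs_inner_toEuclideanCLM_le {d : ℕ} (A : Matrix (Fin d) (Fin d) ℝ) {v : Vec d}
    (hv : ‖v‖ = 1) :
    |inner ℝ v (Matrix.toEuclideanCLM (n := Fin d) (𝕜 := ℝ) A v)| ≤ opNorm A := by
  refine (abs_real_inner_le_norm _ _).trans ?_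
  have := (Matrix.toEuclideanCLM (n := Fin d) (𝕜 := ℝ) A).le_opNorm v
  rw [hv, mul_one] at this
  rw [hv, one_mul]
  exact this

/-- Weyl's inequality, from the Rayleigh quotients of A and A + E. It turns the test on the
perturbed Hessian into a bound for the true one. -/
lemma minEig_add_le {d : ℕ} (hd : 0 < d) {A E : Matrix (Fin d) (Fin d) ℝ} (hA : A.IsSymm)
    (hE : E.IsSymm) : minEig (A + E) - opNorm E ≤ minEig A := by
  refine le_minEig hd hA fun v hv => ?_
  have h1 := minEig_mul_norm_sq_le (hA.add hE) v
  rw [hv, map_add, add_apply, inner_add_right] at h1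
  have h2 := (abs_le.1 (abs_inner_toEuclideanCLM_le E hv)).2
  linarith

/-! ### Regularity of the empirical risk -/

section Risk

variable {X : Type u} {d n : ℕ} {p : Params} {l : Vec d → X → ℝ}

lemma contDiff_risk (hl : LossAssumption p l) (D : Fin n → X) : ContDiff ℝ 2 (risk l D) :=
  contDiff_const.mul (ContDiff.sum fun i _ => hl.contDiff (D i))

lemma gradient_risk (hl : LossAssumption p l) (D : Fin n → X) :
    gradient (risk l D) =
      fun w => (1 / (n : ℝ)) • ∑ i, gradient (fun v => l v (D i)) w := by
  refine gradient_eq fun w => ?_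
  rw [hasGradientAt_iff_hasFDerivAt, map_smul, map_sum]
  refine HasFDerivAt.const_mul (HasFDerivAt.fun_sum fun i _ => ?_) _
  exact ((hl.contDiff (D i)).differentiable two_ne_zero w).hasGradientAt.hasFDerivAt

lemma fderiv_gradient_risk (hl : LossAssumption p l) (D : Fin n → X) (w : Vec d) :
    fderiv ℝ (gradient (risk l D)) w =
      (1 / (n : ℝ)) • ∑ i, fderiv ℝ (gradient fun v => l v (D i)) w := by
  rw [gradient_risk hl D]
  have h : HasFDerivAt (fun w => ∑ i, gradient (fun v => l v (D i)) w)
      (∑ i, fderiv ℝ (gradient fun v => l v (D i)) w) w :=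
    HasFDerivAt.fun_sum fun i _ => (differentiable_gradient (hl.contDiff (D i)) w).hasFDerivAt
  exact (h.const_smul (1 / (n : ℝ))).fderiv

lemma norm_average_le {E : Type*} [NormedAddCommGroup E] [NormedSpace ℝ E] (hn : 0 < n)
    {a : Fin n → E} {b : ℝ} (h : ∀ i, ‖a i‖ ≤ b) : ‖(1 / (n : ℝ)) • ∑ i, a i‖ ≤ b := by
  have hn' : (0 : ℝ) < n := by exact_mod_cast hn
  have h1 : ‖∑ i, a i‖ ≤ n * b := by
    refine (norm_sum_le _ _).trans ((Finset.sum_le_sum fun i _ => h i).trans ?_)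
    simp
  rw [norm_smul, Real.norm_of_nonneg (by positivity)]
  calc 1 / (n : ℝ) * ‖∑ i, a i‖ ≤ 1 / n * (n * b) := by gcongr
    _ = b := by field_simp

lemma norm_average_sub_le {E : Type*} [NormedAddCommGroup E] [NormedSpace ℝ E] (hn : 0 < n)
    {a b : Fin n → E} {c : ℝ} (h : ∀ i, ‖a i - b i‖ ≤ c) :
    ‖(1 / (n : ℝ)) • ∑ i, a i - (1 / (n : ℝ)) • ∑ i, b i‖ ≤ c := by
  rw [← smul_sub, ← Finset.sum_sub_distrib]
  exact norm_average_le hn h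

lemma gradient_risk_lipschitz (hl : LossAssumption p l) (hn : 0 < n) (D : Fin n → X)
    (w₁ w₂ : Vec d) :
    ‖gradient (risk l D) w₁ - gradient (risk l D) w₂‖ ≤ p.G * ‖w₁ - w₂‖ := by
  rw [gradient_risk hl D]
  exact norm_average_sub_le hn fun i => hl.grad_lip (D i) w₁ w₂

lemma fderiv_gradient_risk_lipschitz (hl : LossAssumption p l) (hn : 0 < n) (D : Fin n → X)
    (w₁ w₂ : Vec d) :
    ‖fderiv ℝ (gradient (risk l D)) w₁ - fderiv ℝ (gradient (risk l D)) w₂‖ ≤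
      p.M * ‖w₁ - w₂‖ := by
  rw [fderiv_gradient_risk hl D, fderiv_gradient_risk hl D]
  refine norm_average_sub_le hn fun i => ?_
  have h := hl.hess_lip (D i) w₁ w₂
  rwa [opNorm, map_sub, toEuclideanCLM_hessian, toEuclideanCLM_hessian] at h

end Risk

/-! ### The scalar parameters -/

namespace Params

variable {p : Params}

lemma Valid.disc_nonneg (hp : p.Valid) :
    0 ≤ 1 / 4 * (1 - p.c - p.cH) ^ 2 - 2 / 3 * p.c2 := by
  have h0 := Real.sqrt_nonneg (8 / 3 * p.c2)
  have h1 := hp.cH_lt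
  have h2 := Real.sq_sqrt (show 0 ≤ 8 / 3 * p.c2 by linarith [hp.c2_pos])
  nlinarith

lemma Valid.sum_pos (hp : p.Valid) : 0 < 1 - p.c - p.cH := by
  linarith [hp.cH_lt, Real.sqrt_nonneg (8 / 3 * p.c2)]

lemma Valid.t2_pos (hp : p.Valid) : 0 < p.t2 := by
  have := hp.sum_pos
  have h := Real.sqrt_nonneg (1 / 4 * (1 - p.c - p.cH) ^ 2 - 2 / 3 * p.c2)
  unfold t2; linarith

lemma Valid.t1_pos (hp : p.Valid) : 0 < p.t1 := by
  have h0 := hp.sum_pos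
  have h : √(1 / 4 * (1 - p.c - p.cH) ^ 2 - 2 / 3 * p.c2) < 1 / 2 * (1 - p.c - p.cH) := by
    rw [Real.sqrt_lt' (by linarith)]
    nlinarith [hp.c2_pos]
  unfold t1; linarith

/-- For the step length t|μ|/M, the cubic Taylor bound yields the decrease required by c_H as soon
as this quadratic in t is nonnegative; at t₂ it does so with equality. -/
lemma Valid.t2_root (hp : p.Valid) :
    -p.t2 ^ 2 / 6 + (1 - p.c - p.cH) * p.t2 / 2 - p.c2 = 0 := by
  have h := Real.sq_sqrt hp.disc_nonneg
  unfold t2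
  nlinarith

lemma Valid.βH_pos (hp : p.Valid) : 0 < p.βH :=
  (div_pos hp.t1_pos hp.t2_pos).trans hp.βH_gt

lemma Valid.minDec_pos (hp : p.Valid) {εg εH : ℝ} (hg : 0 < εg) (hH : 0 < εH) :
    0 < p.minDec εg εH := by
  have h1 := hp.cg_lt
  have := hp.G_pos
  have := hp.M_pos
  have := hp.cg_pos
  have := hp.cH_pos
  have := hp.t2_pos
  have h2 : 0 < 1 - p.c1 - p.cg := by linarith
  exact lt_min (by positivity) (by positivity)

end Params

/-! ### The line search -/

/-- Only two outcomes matter below: the fallback, or a trial step that passed its noisy test.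
Minimality of the accepted trial plays no role. -/
lemma svtLoop_spec (q : ℝ → ℝ) (thr s γbar β : ℝ) (ν : ℕ → ℝ) (m i : ℕ) (γ : ℝ) :
    svtLoop q thr s γbar β ν m i γ = γbar ∨
      ∃ j < m, svtLoop q thr s γbar β ν m i γ = β ^ j * γ ∧
        thr ≤ q (β ^ j * γ) + s * ν (i + j) := by
  induction m generalizing i γ with
  | zero => exact Or.inl rfl
  | succ m ih =>
    rw [svtLoop]
    split_ifs with h
    · exact Or.inr ⟨0, Nat.succ_pos m, by simp, by simpa using h⟩
    · rcases ih (i + 1) (β * γ) with h' | ⟨j, hj, h1, h2⟩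
      · exact Or.inl h'
      · refine Or.inr ⟨j + 1, Nat.succ_lt_succ hj, ?_, ?_⟩
        · rw [h1]; ring
        · rw [show β ^ (j + 1) * γ = β ^ j * (β * γ) by ring,
            show i + (j + 1) = i + 1 + j by ring]
          exact h2

/-- When the noise is bounded, the line search returns a step of length at least `γbar`, which is
`γbar` or makes the query at least as large as minus the total noise. -/
lemma dpLineSearch_spec {q : ℝ → ℝ} {Δ b γbar β lam x ℓ : ℝ} {ν : ℕ → ℝ} {m : ℕ}
    (hb : 1 < b) (hγ : 0 < γbar) (hβ0 : 0 < β) (hβ1 : β < 1) (hΔ : 0 ≤ lam * Δ)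
    (hm : ⌊Real.logb β (1 / b)⌋₊ + 1 ≤ m) (hx : -(2 * ℓ) ≤ x) (hν : ∀ i < m, ν i ≤ ℓ) :
    γbar ≤ dpLineSearch q Δ (b * γbar) γbar β lam x ν ∧
      (dpLineSearch q Δ (b * γbar) γbar β lam x ν = γbar ∨
        -(8 * ℓ * (lam * Δ)) ≤ q (dpLineSearch q Δ (b * γbar) γbar β lam x ν)) := by
  have hb0 : 0 < b := by linarith
  have hdiv : γbar / (b * γbar) = 1 / b := by field_simp
  have hlog : 0 ≤ Real.logb β (1 / b) :=
    Real.logb_nonneg_of_base_lt_one hβ0 hβ1 (by positivity) (by rw [div_le_one hb0]; exact hb.le)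
  rcases svtLoop_spec q (2 * lam * Δ * x) (4 * lam * Δ) γbar β ν
    (⌊Real.logb β (γbar / (b * γbar))⌋₊ + 1) 0 (b * γbar) with h | ⟨j, hj, h1, h2⟩
  · rw [dpLineSearch, h]
    exact ⟨le_rfl, Or.inl rfl⟩
  · rw [dpLineSearch, h1]
    rw [hdiv] at hj
    have hjf : (j : ℝ) ≤ Real.logb β (1 / b) :=
      (Nat.cast_le.2 (Nat.lt_succ_iff.1 hj)).trans (Nat.floor_le hlog)
    -- The number of trials is such that j ≤ log_β(1/b); since β < 1, backtracking from b γ̄ never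
    -- goes below γ̄.
    have hpow : 1 / b ≤ β ^ j := by
      rw [← Real.rpow_natCast]
      calc 1 / b = β ^ Real.logb β (1 / b) :=
            (Real.rpow_logb hβ0 hβ1.ne (by positivity)).symm
        _ ≤ β ^ (j : ℝ) := Real.rpow_le_rpow_of_exponent_ge hβ0 hβ1.le hjf
    refine ⟨?_, Or.inr ?_⟩
    · calc γbar = 1 / b * (b * γbar) := by field_simp
        _ ≤ β ^ j * (b * γbar) := by gcongr
    · rw [zero_add] at h2
      -- The threshold contributes 2λΔ · 2ℓ and the query 4λΔ · ℓ, hence the total 8ℓλΔ. The bound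
      -- 2ℓ on the threshold balances its smaller scale.
      have h3 := hν j (by omega)
      have h4 := mul_le_mul_of_nonneg_left hx hΔ
      have h5 := mul_le_mul_of_nonneg_left h3 hΔ
      linarith

/-! ### One iteration of the algorithm -/

lemma opNorm_smul {d : ℕ} {a : ℝ} (ha : 0 ≤ a) (A : Matrix (Fin d) (Fin d) ℝ) :
    opNorm (a • A) = a * opNorm A := by
  rw [opNorm, map_smul, norm_smul, Real.norm_of_nonneg ha, opNorm]

lemma isSymm_symMat {d : ℕ} (e : Fin d → Fin d → ℝ) : (symMat e).IsSymm := by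
  ext i j
  rcases lt_trichotomy i j with h | rfl | h
  · simp [symMat, h.le, not_le.2 h]
  · simp [symMat]
  · simp [symMat, h.le, not_le.2 h]

namespace Setup

variable {X : Type u} {d n : ℕ}

/-- The noise of one iteration is small compared with the tolerances, where `ℓ` bounds the
Laplace noise. -/
structure SmallNoise (S : Setup X d n) (T : ℕ) (ℓ : ℝ) (η : IterNoise d) : Prop where
  grad : S.p.Δg n * S.σg T * ‖(WithLp.toLp 2 η.1 : Vec d)‖ ≤
    min (S.p.c1 * S.εg) (S.p.c2 / S.p.M * S.εH ^ 2)
  hess : S.p.ΔH d n * S.σH T * opNorm (symMat η.2.1) ≤ S.p.c * S.εH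
  threshold : -(2 * ℓ) ≤ η.2.2.1
  query : ∀ i < S.p.imax, η.2.2.2 i ≤ ℓ

variable {S : Setup X d n} {T : ℕ} {ℓ : ℝ} {η : IterNoise d}

lemma Valid.Δg_nonneg (hS : S.Valid) : 0 ≤ S.p.Δg n := by
  have := hS.params.Bg_nonneg
  unfold Params.Δg; positivity

lemma Valid.ΔH_nonneg (hS : S.Valid) : 0 ≤ S.p.ΔH d n := by
  have := hS.params.BH_nonneg
  unfold Params.ΔH; positivity

lemma Valid.contDiff (hS : S.Valid) : ContDiff ℝ 2 S.f := contDiff_risk hS.loss S.D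

lemma norm_gradient_sub_noisyGrad_le (hS : S.Valid) (hη : S.SmallNoise T ℓ η) (w : Vec d) :
    ‖gradient S.f w - S.noisyGrad T w η‖ ≤
      min (S.p.c1 * S.εg) (S.p.c2 / S.p.M * S.εH ^ 2) := by
  have h := hη.grad
  rwa [noisyGrad, sub_add_cancel_left, norm_neg, norm_smul,
    Real.norm_of_nonneg (mul_nonneg hS.Δg_nonneg (hS.σg_nonneg T))]

lemma opNorm_smul_symMat_le (hS : S.Valid) (hη : S.SmallNoise T ℓ η) :
    opNorm ((S.p.ΔH d n * S.σH T) • symMat η.2.1) ≤ S.p.c * S.εH := by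
  rw [opNorm_smul (mul_nonneg hS.ΔH_nonneg (hS.σH_nonneg T))]
  exact hη.hess

lemma isSymm_noisyHess (hS : S.Valid) (w : Vec d) : (S.noisyHess T w η).IsSymm :=
  (isSymm_hessian hS.contDiff w).add ((isSymm_symMat _).smul _)

/-- The test prescribes the decrease c_g γ̄ ‖g‖² at γ̄, and the sample size makes the noise at most
half of it. The remaining half exceeds ½ c_g γ̄ ε_g², the first entry of MIN_DEC. -/
lemma f_gradStep_lt (hS : S.Valid) (hη : S.SmallNoise T ℓ η)
    (hn : 16 * S.lam T * ℓ * S.p.Bg * (2 * S.p.bg / (S.p.cg * S.εg)) ≤ n) {w g : Vec d}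
    (hg : S.εg < ‖g‖) (hgw : ‖gradient S.f w - g‖ ≤ S.p.c1 * S.εg) :
    S.f (S.gradStep T w g η) + S.p.minDec S.εg S.εH < S.f w := by
  have hp := hS.params
  have hG := hp.G_pos
  have hcg := hp.cg_pos
  have hc1 := hp.c1_pos
  have hε := hS.εg_pos
  have hlam := hS.lam_nonneg T
  have hBg := hp.Bg_nonneg
  have hbg : 0 < S.p.bg := by linarith [hp.bg_gt]
  have hn0 : (0 : ℝ) < n := by exact_mod_cast hS.n_pos
  have hs : 0 < 1 - S.p.c1 - S.p.cg := by linarith [hp.cg_lt]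
  have hg0 : 0 < ‖g‖ := hε.trans hg
  rw [gradStep]
  set γbar := 2 * (1 - S.p.c1 - S.p.cg) / S.p.G with hγdef
  have hγ : 0 < γbar := by positivity
  set Δ := 2 / (n : ℝ) * (S.p.bg * γbar) * S.p.Bg * ‖g‖ with hΔdef
  have hΔ : 0 ≤ Δ := by positivity
  obtain ⟨h1, h2⟩ := dpLineSearch_spec
    (q := fun γ : ℝ => S.f w - S.f (w - γ • g) - S.p.cg * γ * ‖g‖ ^ 2) hp.bg_gt hγ hp.βg_pos
    hp.βg_lt (mul_nonneg hlam hΔ) (le_max_left _ _) hη.threshold hη.query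
  set γ := dpLineSearch (fun γ : ℝ => S.f w - S.f (w - γ • g) - S.p.cg * γ * ‖g‖ ^ 2) Δ
    (S.p.bg * γbar) γbar S.p.βg (S.lam T) η.2.2.1 η.2.2.2
  have hnoise : 8 * ℓ * (S.lam T * Δ) ≤ 1 / 2 * S.p.cg * γbar * ‖g‖ ^ 2 := by
    have h3 : 16 * S.lam T * ℓ * S.p.Bg * S.p.bg / n ≤ 1 / 2 * S.p.cg * S.εg := by
      rw [div_le_iff₀ hn0]
      rw [mul_div_assoc', div_le_iff₀ (by positivity)] at hn
      linarith
    calc 8 * ℓ * (S.lam T * Δ)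
        = 16 * S.lam T * ℓ * S.p.Bg * S.p.bg / n * (γbar * ‖g‖) := by rw [hΔdef]; ring
      _ ≤ 1 / 2 * S.p.cg * S.εg * (γbar * ‖g‖) := by gcongr
      _ ≤ 1 / 2 * S.p.cg * ‖g‖ * (γbar * ‖g‖) := by gcongr
      _ = _ := by ring
  have hdec : S.f (w - γ • g) + 1 / 2 * S.p.cg * γbar * ‖g‖ ^ 2 ≤ S.f w := by
    rcases h2 with h2 | h2
    · rw [h2]
      have h4 := le_quadratic_of_gradient_lipschitz hS.contDiff
        (gradient_risk_lipschitz hS.loss hS.n_pos S.D) w (-(γbar • g))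
      rw [← sub_eq_add_neg, inner_neg_right, norm_neg, norm_smul, Real.norm_of_nonneg hγ.le,
        real_inner_smul_right] at h4
      change S.f (w - γbar • g) ≤ S.f w + _ + _ at h4
      have h5 : inner ℝ (gradient S.f w) g = ‖g‖ ^ 2 + inner ℝ (gradient S.f w - g) g := by
        rw [inner_sub_left, real_inner_self_eq_norm_sq]; ring
      have h6 := (abs_le.1 (abs_real_inner_le_norm (gradient S.f w - g) g)).1
      have h7 : ‖gradient S.f w - g‖ * ‖g‖ ≤ S.p.c1 * ‖g‖ ^ 2 := by
        rw [pow_two, ← mul_assoc]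
        gcongr
        exact hgw.trans (by gcongr)
      have h8 : (1 - S.p.c1) * ‖g‖ ^ 2 ≤ inner ℝ (gradient S.f w) g := by linarith
      have h9 := mul_le_mul_of_nonneg_left h8 hγ.le
      -- The value of γ̄ lets the quadratic loss use up exactly 1 - c₁ - c_g, which leaves c_g for
      -- the decrease.
      have h10 : S.p.G / 2 * (γbar * ‖g‖) ^ 2 =
          (1 - S.p.c1 - S.p.cg) * γbar * ‖g‖ ^ 2 := by
        rw [hγdef]; field_simp
      have h11 : 0 ≤ S.p.cg * γbar * ‖g‖ ^ 2 := by positivity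
      linarith
    · have h3 : S.p.cg * γbar * ‖g‖ ^ 2 ≤ S.p.cg * γ * ‖g‖ ^ 2 := by gcongr
      linarith
  have hmin : S.p.minDec S.εg S.εH ≤ 1 / 2 * S.p.cg * γbar * S.εg ^ 2 := by
    refine (min_le_left _ _).trans (le_of_eq ?_)
    rw [hγdef]; ring
  have hlt : 1 / 2 * S.p.cg * γbar * S.εg ^ 2 < 1 / 2 * S.p.cg * γbar * ‖g‖ ^ 2 := by
    gcongr
  linarith

/-- The prescribed decrease at γ̄ is ½ c_H γ̄² |μ|, and noise takes at most half. With γ̄ = t₂|μ|/M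
the rest is ¼ c_H t₂² |μ|³/M², larger than the second entry of MIN_DEC because |μ| > ε_H. -/
lemma f_curvStep_lt (hS : S.Valid) (hη : S.SmallNoise T ℓ η)
    (hn : 16 * S.lam T * ℓ * S.p.Bg * (4 * S.p.bH * S.p.M / (S.p.t2 * S.p.cH * S.εH ^ 2)) ≤ n)
    {w g v : Vec d} {E : Matrix (Fin d) (Fin d) ℝ} {μ : ℝ} (hμ : μ < -S.εH)
    (hgw : ‖gradient S.f w - g‖ ≤ S.p.c2 / S.p.M * S.εH ^ 2) (hE : opNorm E ≤ S.p.c * S.εH)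
    (hv : ‖v‖ = 1) (hvg : inner ℝ v g ≤ 0)
    (hev : Matrix.toEuclideanCLM (n := Fin d) (𝕜 := ℝ) (hessian S.f w + E) v = μ • v) :
    S.f (S.curvStep T w μ v η) + S.p.minDec S.εg S.εH < S.f w := by
  have hp := hS.params
  have hM := hp.M_pos
  have hcH := hp.cH_pos
  have hc := hp.c_pos
  have hc2 := hp.c2_pos
  have hε := hS.εH_pos
  have ht2 := hp.t2_pos
  have hlam := hS.lam_nonneg T
  have hBg := hp.Bg_nonneg
  have hbH : 0 < S.p.bH := by linarith [hp.bH_gt]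
  have hn0 : (0 : ℝ) < n := by exact_mod_cast hS.n_pos
  rw [curvStep]
  have hμa : |μ| = -μ := abs_of_neg (by linarith)
  set a := |μ| with hadef
  have ha : S.εH < a := by linarith
  have ha0 : 0 < a := by linarith
  set γbar := S.p.t2 * a / S.p.M with hγdef
  have hγ : 0 < γbar := by positivity
  set Δ := 2 / (n : ℝ) * (S.p.bH * γbar) * S.p.Bg with hΔdef
  have hΔ : 0 ≤ Δ := by positivity
  obtain ⟨h1, h2⟩ := dpLineSearch_spec
    (q := fun γ : ℝ => S.f w - S.f (w + γ • v) - 1 / 2 * S.p.cH * γ ^ 2 * a) hp.bH_gt hγ hp.βH_pos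
    hp.βH_lt (mul_nonneg hlam hΔ) (le_max_right _ _) hη.threshold hη.query
  set γ := dpLineSearch (fun γ : ℝ => S.f w - S.f (w + γ • v) - 1 / 2 * S.p.cH * γ ^ 2 * a) Δ
    (S.p.bH * γbar) γbar S.p.βH (S.lam T) η.2.2.1 η.2.2.2
  have hnoise : 8 * ℓ * (S.lam T * Δ) ≤ 1 / 4 * S.p.cH * γbar ^ 2 * a := by
    have h3 : 16 * S.lam T * ℓ * S.p.Bg * S.p.bH / n ≤
        1 / 4 * S.p.cH * (S.p.t2 * S.εH ^ 2 / S.p.M) := by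
      rw [mul_div_assoc', div_le_div_iff₀ hn0 hM]
      rw [mul_div_assoc', div_le_iff₀ (by positivity)] at hn
      linarith
    have h4 : S.εH ^ 2 ≤ a ^ 2 := by gcongr
    calc 8 * ℓ * (S.lam T * Δ)
        = 16 * S.lam T * ℓ * S.p.Bg * S.p.bH / n * γbar := by rw [hΔdef]; ring
      _ ≤ 1 / 4 * S.p.cH * (S.p.t2 * S.εH ^ 2 / S.p.M) * γbar := by gcongr
      _ ≤ 1 / 4 * S.p.cH * (S.p.t2 * a ^ 2 / S.p.M) * γbar := by gcongr
      _ = _ := by rw [hγdef]; ring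
  have hdec : S.f (w + γ • v) + 1 / 4 * S.p.cH * γbar ^ 2 * a ≤ S.f w := by
    have hpos : 0 ≤ S.p.cH * γbar ^ 2 * a := by positivity
    rcases h2 with h2 | h2
    · rw [h2]
      have h4 := le_cubic_of_hessian_lipschitz hS.contDiff
        (fderiv_gradient_risk_lipschitz hS.loss hS.n_pos S.D) w (γbar • v)
      rw [map_smul, norm_smul, Real.norm_of_nonneg hγ.le, hv, mul_one, real_inner_smul_right,
        real_inner_smul_right, real_inner_smul_left] at h4
      -- The sign of the eigenvector removes ⟪v, g⟫, so only the gradient error remains; its bound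
      -- c₂ε_H²/M is of the order of the other terms.
      have h5 : inner ℝ (gradient S.f w) v ≤ S.p.c2 * a ^ 2 / S.p.M := by
        have h6 := real_inner_le_norm (gradient S.f w - g) v
        rw [inner_sub_left, hv, mul_one, real_inner_comm v g] at h6
        have h7 : S.p.c2 / S.p.M * S.εH ^ 2 ≤ S.p.c2 * a ^ 2 / S.p.M := by
          rw [div_mul_eq_mul_div]; gcongr
        linarith
      have h6 : inner ℝ (fderiv ℝ (gradient S.f) w v) v ≤ -((1 - S.p.c) * a) := by
        have h7 := (abs_le.1 (abs_inner_toEuclideanCLM_le E hv)).1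
        rw [map_add, toEuclideanCLM_hessian, add_apply] at hev
        have h8 := congrArg (fun u => inner ℝ v u) hev
        simp only [inner_add_right, real_inner_smul_right, real_inner_self_eq_norm_sq, hv] at h8
        rw [real_inner_comm]
        have h9 : S.p.c * S.εH ≤ S.p.c * a := by gcongr
        linarith
      have h7 := mul_le_mul_of_nonneg_left h5 hγ.le
      have h8 := mul_le_mul_of_nonneg_left h6 (by positivity : 0 ≤ γbar ^ 2 / 2)
      -- The root equation for t₂, multiplied by t₂|μ|³/M² up to sign.
      have h9 : γbar * (S.p.c2 * a ^ 2 / S.p.M) - γbar ^ 2 / 2 * ((1 - S.p.c) * a) +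
          S.p.M / 6 * γbar ^ 3 = -(1 / 2 * S.p.cH * γbar ^ 2 * a) := by
        have hroot := hp.t2_root
        have h10 : S.p.c2 = -S.p.t2 ^ 2 / 6 + (1 - S.p.c - S.p.cH) * S.p.t2 / 2 := by linarith
        rw [h10, hγdef]
        field_simp
        ring
      change S.f (w + γbar • v) ≤ S.f w + γbar * inner ℝ (gradient S.f w) v +
        γbar * (γbar * inner ℝ (fderiv ℝ (gradient S.f) w v) v) / 2 + _ at h4
      linarith
    · have h3 : S.p.cH * γbar ^ 2 * a ≤ S.p.cH * γ ^ 2 * a := by gcongr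
      linarith
  have hmin : S.p.minDec S.εg S.εH ≤ 1 / 4 * S.p.cH * S.p.t2 ^ 2 * (S.εH ^ 3 / S.p.M ^ 2) :=
    min_le_right _ _
  have hlt : 1 / 4 * S.p.cH * S.p.t2 ^ 2 * (S.εH ^ 3 / S.p.M ^ 2) <
      1 / 4 * S.p.cH * γbar ^ 2 * a := by
    calc _ < 1 / 4 * S.p.cH * S.p.t2 ^ 2 * (a ^ 3 / S.p.M ^ 2) := by gcongr
      _ = _ := by rw [hγdef]; ring
  linarith

lemma is2S_of_noisy (hS : S.Valid) (hη : S.SmallNoise T ℓ η) {w : Vec d}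
    (hg : ‖S.noisyGrad T w η‖ ≤ S.εg) (hH : -S.εH ≤ minEig (S.noisyHess T w η)) :
    Is2S S.f ((1 + S.p.c1) * S.εg) ((1 + S.p.c) * S.εH) w := by
  constructor
  · have h1 := (norm_gradient_sub_noisyGrad_le hS hη w).trans (min_le_left _ _)
    have h2 := norm_le_norm_sub_add (gradient S.f w) (S.noisyGrad T w η)
    linarith
  · have h1 := minEig_add_le hS.d_pos (isSymm_hessian hS.contDiff w)
      ((isSymm_symMat η.2.1).smul (S.p.ΔH d n * S.σH T))
    have h2 := opNorm_smul_symMat_le hS hη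
    rw [noisyHess] at hH
    linarith

/-! ### The main loop -/

/-- Each iteration either stops at a good point or lowers f by more than MIN_DEC, and strict
decreases add up. The case m = 0 is separate because a strict decrease needs at least one step. -/
lemma loop_spec (hS : S.Valid) (hℓ : 0 ≤ ℓ)
    (hn : 16 * S.lam T * ℓ * S.p.Bg * max (2 * S.p.bg / (S.p.cg * S.εg))
      (4 * S.p.bH * S.p.M / (S.p.t2 * S.p.cH * S.εH ^ 2)) ≤ n) (ω : ℕ → IterNoise d) (m k : ℕ)
    (w : Vec d) (hω : ∀ j < m, S.SmallNoise T ℓ (ω (k + j))) :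
    m = 0 ∨ (∃ w', S.loop T ω m k w = some w' ∧
        Is2S S.f ((1 + S.p.c1) * S.εg) ((1 + S.p.c) * S.εH) w') ∨
      ∃ w', S.f w' + m * S.p.minDec S.εg S.εH < S.f w := by
  induction m generalizing k w with
  | zero => exact Or.inl rfl
  | succ m ih =>
    right
    have hcoef : 0 ≤ 16 * S.lam T * ℓ * S.p.Bg := by
      have := hS.lam_nonneg T
      have := hS.params.Bg_nonneg
      positivity
    have hη : S.SmallNoise T ℓ (ω k) := hω 0 (Nat.succ_pos m)
    have hrest : ∀ j < m, S.SmallNoise T ℓ (ω (k + 1 + j)) := fun j hj => by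
      have := hω (j + 1) (Nat.succ_lt_succ hj)
      rwa [show k + (j + 1) = k + 1 + j by ring] at this
    have hcont : ∀ w₁, S.f w₁ + S.p.minDec S.εg S.εH < S.f w →
        (∃ w', S.loop T ω m (k + 1) w₁ = some w' ∧
          Is2S S.f ((1 + S.p.c1) * S.εg) ((1 + S.p.c) * S.εH) w') ∨
        ∃ w', S.f w' + ((m + 1 : ℕ) : ℝ) * S.p.minDec S.εg S.εH < S.f w := by
      intro w₁ hw₁
      rcases ih (k + 1) w₁ hrest with rfl | h | ⟨w', hw'⟩
      · exact Or.inr ⟨w₁, by simpa using hw₁⟩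
      · exact Or.inl h
      · refine Or.inr ⟨w', ?_⟩
        push_cast
        linarith
    have hgrad := norm_gradient_sub_noisyGrad_le hS hη w
    rw [loop]
    split_ifs with h1 h2
    · exact hcont _ (f_gradStep_lt hS hη
        ((mul_le_mul_of_nonneg_left (le_max_left _ _) hcoef).trans hn) h1
        (hgrad.trans (min_le_left _ _)))
    · obtain ⟨hv, hev, hvg⟩ := hS.solver (S.noisyHess T w (ω k)) (S.noisyGrad T w (ω k))
        (isSymm_noisyHess hS w)
      exact hcont _ (f_curvStep_lt hS hη
        ((mul_le_mul_of_nonneg_left (le_max_right _ _) hcoef).trans hn) h2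
        (hgrad.trans (min_le_right _ _)) (opNorm_smul_symMat_le hS hη) hv hvg hev)
    · exact Or.inl ⟨w, rfl, is2S_of_noisy hS hη (not_lt.1 h1) (not_lt.1 h2)⟩

lemma success_of_smallNoise (hS : S.Valid) {z : ℝ} (hT : 0 < S.T z) (hℓ : 0 ≤ ℓ)
    (hn : 16 * S.lam (S.T z) * ℓ * S.p.Bg * max (2 * S.p.bg / (S.p.cg * S.εg))
      (4 * S.p.bH * S.p.M / (S.p.t2 * S.p.cH * S.εH ^ 2)) ≤ n) {ω : ℕ → IterNoise d}
    (hω : ∀ j < S.T z, S.SmallNoise (S.T z) ℓ (ω j)) : S.Success z ω := by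
  rcases loop_spec hS hℓ hn ω (S.T z) 0 S.w0 (by simpa using hω) with h | h | ⟨w', hw'⟩
  · omega
  · exact h
  · exfalso
    -- By the ceiling, T · MIN_DEC covers the whole gap f(w₀) + |z| - flow. T decreases would push f
    -- below flow; the perturbation |z| only enlarges T.
    have h1 : (S.f S.w0 + |z| - S.flow) / S.p.minDec S.εg S.εH ≤ S.T z := Nat.le_ceil _
    rw [div_le_iff₀ (hS.params.minDec_pos hS.εg_pos hS.εH_pos)] at h1
    linarith [hS.flow_le w', abs_nonneg z]

end Setup

/-! ### The order of the required sample size -/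

namespace Params

variable {p : Params}

lemma imax_pos (p : Params) : 0 < p.imax :=
  (Nat.succ_pos _).trans_le (le_max_left _ _)

/-- The iteration bound is `O(max (εg⁻², εH⁻³))`; here `x = εg⁻¹` and `y = εH^(-1/2)`. -/
lemma Valid.exists_iterBound_le (hp : p.Valid) {F : ℝ} (hF : 0 < F) :
    ∃ A : ℝ, 0 < A ∧ ∀ εg εH x y gap : ℝ, 0 < εg → 0 < εH → 1 ≤ x → 1 ≤ y → x * εg = 1 →
      y ^ 2 * εH = 1 → gap ≤ F → (p.iterBound εg εH gap : ℝ) ≤ A * max x (y ^ 3) ^ 2 := by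
  have h1 := hp.G_pos
  have h2 := hp.M_pos
  have h3 := hp.cg_pos
  have h4 := hp.cH_pos
  have h5 := hp.t2_pos
  have h6 : 0 < 1 - p.c1 - p.cg := by linarith [hp.cg_lt]
  set a := 1 / p.G * (1 - p.c1 - p.cg) * p.cg with hadef
  set b := 1 / 4 * p.cH * p.t2 ^ 2 / p.M ^ 2 with hbdef
  have ha : 0 < a := by positivity
  have hb : 0 < b := by positivity
  -- The sum 1/a + 1/b covers both cases of the minimum in MIN_DEC, and the extra 1 pays for the
  -- ceiling since x ≥ 1.
  refine ⟨F * (1 / a + 1 / b) + 1, by positivity, ?_⟩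
  intro εg εH x y gap hεg hεH hx hy hxε hyε hgap
  have hm := hp.minDec_pos hεg hεH
  set Z := max x (y ^ 3) with hZ
  have hZ1 : 1 ≤ Z := hx.trans (le_max_left _ _)
  have hinv : 1 / p.minDec εg εH ≤ (1 / a + 1 / b) * Z ^ 2 := by
    rw [div_le_iff₀ hm, minDec]
    rcases min_choice (1 / p.G * (1 - p.c1 - p.cg) * p.cg * εg ^ 2)
      (1 / 4 * p.cH * p.t2 ^ 2 * (εH ^ 3 / p.M ^ 2)) with h | h
    · rw [h, ← hadef]
      have h7 : 1 ≤ (Z * εg) ^ 2 := by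
        refine one_le_pow₀ ?_
        rw [← hxε]; gcongr; exact le_max_left _ _
      calc (1 : ℝ) ≤ (Z * εg) ^ 2 := h7
        _ = 1 / a * Z ^ 2 * (a * εg ^ 2) := by field_simp
        _ ≤ _ := by gcongr; linarith [show 0 < 1 / b by positivity]
    · have h8 : 1 / 4 * p.cH * p.t2 ^ 2 * (εH ^ 3 / p.M ^ 2) = b * εH ^ 3 := by
        rw [hbdef]; ring
      rw [h, h8]
      have h7 : 1 ≤ Z ^ 2 * εH ^ 3 := by
        calc (1 : ℝ) = (y ^ 3) ^ 2 * εH ^ 3 := by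
              rw [show (y ^ 3) ^ 2 * εH ^ 3 = (y ^ 2 * εH) ^ 3 by ring, hyε, one_pow]
          _ ≤ _ := by gcongr; exact le_max_right _ _
      calc (1 : ℝ) ≤ Z ^ 2 * εH ^ 3 := h7
        _ = 1 / b * Z ^ 2 * (b * εH ^ 3) := by field_simp
        _ ≤ _ := by gcongr; linarith [show 0 < 1 / a by positivity]
  have hceil : (p.iterBound εg εH gap : ℝ) ≤ F * (1 / p.minDec εg εH) + 1 := by
    have h7 : p.iterBound εg εH gap ≤ ⌈F / p.minDec εg εH⌉₊ :=
      Nat.ceil_mono (by gcongr)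
    have h8 : ((⌈F / p.minDec εg εH⌉₊ : ℕ) : ℝ) ≤ F / p.minDec εg εH + 1 :=
      (Nat.ceil_lt_add_one (by positivity)).le
    rw [mul_one_div]
    exact (Nat.cast_le.2 h7).trans h8
  calc (p.iterBound εg εH gap : ℝ) ≤ F * ((1 / a + 1 / b) * Z ^ 2) + 1 * Z ^ 2 := by
        refine hceil.trans (add_le_add (by gcongr) ?_)
        rw [one_mul]; exact one_le_pow₀ hZ1
    _ = _ := by ring

end Params

lemma log_div_le {A ζ x y t : ℝ} (hA : 0 < A) (hζ : 0 < ζ) (hx : 1 ≤ x) (hy : 1 ≤ y)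
    (ht0 : 0 ≤ t) (ht : t ≤ A * max x (y ^ 3) ^ 2) :
    Real.log (t / ζ) ≤ (|Real.log (A / ζ)| + 3) * (1 + Real.log x + Real.log (y ^ 2)) := by
  have hlx := Real.log_nonneg hx
  have hly := Real.log_nonneg hy
  have habs := abs_nonneg (Real.log (A / ζ))
  rw [Real.log_pow]
  push_cast
  -- For t = 0 the logarithm takes its default value 0. Otherwise log t is at most log A + 2 log x +
  -- 3 log(y²), whence the constant 3.
  rcases ht0.eq_or_lt with rfl | htpos
  · rw [zero_div, Real.log_zero]; positivity
  have hmax : max x (y ^ 3) ≤ x * y ^ 3 :=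
    max_le (le_mul_of_one_le_right (by linarith) (one_le_pow₀ hy))
      (le_mul_of_one_le_left (by positivity) hx)
  have h1 : t / ζ ≤ A / ζ * (x * y ^ 3) ^ 2 := by
    rw [div_mul_eq_mul_div]
    gcongr
    exact ht.trans (by gcongr)
  have hx0 : x ≠ 0 := by linarith
  have hy0 : y ≠ 0 := by linarith
  have h2 : Real.log (t / ζ) ≤
      Real.log (A / ζ) + 2 * (Real.log x + 3 * Real.log y) := by
    refine (Real.log_le_log (by positivity) h1).trans (le_of_eq ?_)
    rw [Real.log_mul (by positivity) (by positivity), Real.log_pow,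
      Real.log_mul hx0 (by positivity), Real.log_pow]
    push_cast; ring
  have h3 := le_abs_self (Real.log (A / ζ))
  nlinarith [mul_nonneg habs hlx, mul_nonneg habs hly]

/-- With x = ε_g⁻¹ and y = ε_H^(-1/2), the first factor comes from √T and the second from the
reciprocal tolerances. The mixed product x y³ is absorbed by x y⁴, which leaves the three powers of
the theorem. -/
lemma max_mul_max_le {x y : ℝ} (hx : 1 ≤ x) (hy : 1 ≤ y) :
    max x (y ^ 3) * max x (y ^ 4) ≤ max (x ^ 2) (max (x * y ^ 4) (y ^ 7)) := by
  have h34 : y ^ 3 ≤ y ^ 4 := pow_le_pow_right₀ hy (by norm_num)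
  rcases max_choice x (y ^ 3) with h | h <;> rcases max_choice x (y ^ 4) with h' | h' <;>
    rw [h, h']
  · exact le_max_of_le_left (by rw [pow_two])
  · exact le_max_of_le_right (le_max_left _ _)
  · refine le_max_of_le_right (le_max_of_le_left ?_)
    rw [mul_comm]; gcongr
  · refine le_max_of_le_right (le_max_of_le_right (le_of_eq ?_))
    ring

lemma sqrt_noise_scale_le {A T ρ ρf cf Z : ℝ} (hA : 0 < A) (hρ : 0 < ρ) (hcf : cf < 1)
    (hρf : ρf ≤ cf * ρ) (hZ : 0 ≤ Z) (hT : T ≤ A * Z ^ 2) :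
    √(3 * T / (2 * (ρ - ρf))) ≤ √(3 * A / (2 * (1 - cf))) * (Z / √ρ) := by
  have h1 : 0 < 1 - cf := by linarith
  have h2 : (1 - cf) * ρ ≤ ρ - ρf := by linarith
  rw [Real.sqrt_le_left (by positivity), mul_pow, div_pow, Real.sq_sqrt (by positivity),
    Real.sq_sqrt hρ.le]
  calc 3 * T / (2 * (ρ - ρf)) ≤ 3 * (A * Z ^ 2) / (2 * ((1 - cf) * ρ)) := by gcongr
    _ = _ := by field_simp

lemma one_div_min_le {a b u v x y : ℝ} (ha : 0 < a) (hb : 0 < b) (hu : 0 < u) (hv : 0 < v)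
    (hx : x * u = 1) (hy : y * v = 1) : 1 / min (a * u) (b * v) ≤ (1 / a + 1 / b) * max x y := by
  have hx0 : 0 < x := by by_contra h; nlinarith
  have hy0 : 0 < y := by by_contra h; nlinarith
  have hm : 0 < max x y := hx0.trans_le (le_max_left _ _)
  rcases min_choice (a * u) (b * v) with h | h <;> rw [h]
  · have : 1 / (a * u) = 1 / a * x := by field_simp; linarith
    rw [this]
    gcongr
    · linarith [show 0 < 1 / b by positivity]
    · exact le_max_left _ _
  · have : 1 / (b * v) = 1 / b * y := by field_simp; linarith
    rw [this]
    gcongr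
    · linarith [show 0 < 1 / a by positivity]
    · exact le_max_right _ _

set_option maxHeartbeats 1000000 in
-- Each term of n_min is noise scale times logarithm times reciprocal tolerance. The scale is at
-- most a constant times Z/√ρ, and the tolerances of the gradient and line search terms contribute V
-- up to constants, so `max_mul_max_le` applies. The Hessian term has d instead of √d but only
-- ε_H⁻¹; writing d/ε_H = √d · (√d ε_H) · ε_H⁻² produces the factor max(1, √d ε_H).
lemma Params.Valid.exists_nMin_le {p : Params} (hp : p.Valid) {C : ℝ} (hC : 0 ≤ C)
    {ζ ξ F cf : ℝ} (hζ : 0 < ζ) (hξ : 0 < ξ) (hF : 0 < F) (hcf : cf < 1) :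
    ∃ K : ℝ, 0 < K ∧ ∀ (d : ℕ) (εg εH gap ρ ρf σ : ℝ), 0 < d → 0 < εg → 0 < εH → εg ≤ 1 →
      εH ≤ 1 → 0 < ρ → ρf ≤ cf * ρ → gap ≤ F →
      σ = √(3 * (p.iterBound εg εH gap : ℝ) / (2 * (ρ - ρf))) →
      p.nMin C d εg εH ζ ξ σ σ σ (p.iterBound εg εH gap) ≤
        K * max 1 (√d * εH) * (√d / √ρ) * (1 + Real.log (1 / εg) + Real.log (1 / εH)) *
          max (εg ^ (-2 : ℝ)) (max (εg ^ (-1 : ℝ) * εH ^ (-2 : ℝ)) (εH ^ (-7 / 2 : ℝ))) := by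
  obtain ⟨A, hA, hT⟩ := hp.exists_iterBound_le hF
  have hM := hp.M_pos
  have hBg := hp.Bg_nonneg
  have hBH := hp.BH_nonneg
  have hc := hp.c_pos
  have hc1 := hp.c1_pos
  have hc2 := hp.c2_pos
  have hcg := hp.cg_pos
  have hcH := hp.cH_pos
  have ht2 := hp.t2_pos
  have hbg : 0 < p.bg := by linarith [hp.bg_gt]
  have hbH : 0 < p.bH := by linarith [hp.bH_gt]
  have himax : 0 ≤ Real.log p.imax :=
    Real.log_nonneg (by exact_mod_cast Nat.succ_le_of_lt p.imax_pos)
  set A₁ := √(3 * A / (2 * (1 - cf))) with hA₁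
  have hA₁0 : 0 ≤ A₁ := Real.sqrt_nonneg _
  set B₁ := |Real.log (A / ζ)| + 3 with hB₁
  set B₂ := Real.log p.imax + (|Real.log (A / ξ)| + 3) with hB₂
  have hB₁0 : 0 ≤ B₁ := by positivity
  have hB₂0 : 0 ≤ B₂ := by positivity
  set K₁ := 2 * √2 * p.Bg * A₁ * B₁ * (1 / p.c1 + 1 / (p.c2 / p.M)) with hK₁
  set K₂ := 2 * C * p.BH * A₁ * B₁ / p.c with hK₂
  set K₃ := 16 * A₁ * B₂ * p.Bg *
    (2 * p.bg / p.cg + 4 * p.bH * p.M / (p.t2 * p.cH)) with hK₃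
  have hK₁0 : 0 ≤ K₁ := by positivity
  have hK₂0 : 0 ≤ K₂ := by positivity
  have hK₃0 : 0 ≤ K₃ := by positivity
  -- All three constants vanish when B_g = B_H = 0; the 1 keeps K positive.
  refine ⟨K₁ + K₂ + K₃ + 1, by positivity, ?_⟩
  intro d εg εH gap ρ ρf σ hd hεg hεH hεg1 hεH1 hρ hρf hgap hσ
  set x := 1 / εg with hx
  set y := √(1 / εH) with hy
  have hx1 : 1 ≤ x := (one_le_div hεg).2 hεg1
  have hysq : y ^ 2 = 1 / εH := Real.sq_sqrt (by positivity)
  have hy1 : 1 ≤ y := Real.one_le_sqrt.2 ((one_le_div hεH).2 hεH1)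
  have hxε : x * εg = 1 := by rw [hx]; field_simp
  have hyε : y ^ 2 * εH = 1 := by rw [hysq]; field_simp
  have hyε2 : y ^ 4 * εH ^ 2 = 1 := by
    rw [show y ^ 4 * εH ^ 2 = (y ^ 2 * εH) ^ 2 by ring, hyε, one_pow]
  have hW : max (εg ^ (-2 : ℝ)) (max (εg ^ (-1 : ℝ) * εH ^ (-2 : ℝ)) (εH ^ (-7 / 2 : ℝ))) =
      max (x ^ 2) (max (x * y ^ 4) (y ^ 7)) := by
    have e1 : εg ^ (-2 : ℝ) = x ^ 2 := by
      rw [Real.rpow_neg hεg.le, hx, one_div, inv_pow]; norm_cast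
    have e2 : εg ^ (-1 : ℝ) = x := by rw [Real.rpow_neg_one, hx, one_div]
    have e3 : εH ^ (-2 : ℝ) = y ^ 4 := by
      rw [show y ^ 4 = (y ^ 2) ^ 2 by ring, hysq, Real.rpow_neg hεH.le, one_div, inv_pow]
      norm_cast
    have e4 : εH ^ (-7 / 2 : ℝ) = y ^ 7 := by
      rw [hy, Real.sqrt_eq_rpow, ← Real.rpow_natCast, ← Real.rpow_mul (by positivity), one_div,
        Real.inv_rpow hεH.le, ← Real.rpow_neg hεH.le]
      norm_num
    rw [e1, e2, e3, e4]
  rw [hW, ← hysq]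
  set t := p.iterBound εg εH gap with ht
  have htA : (t : ℝ) ≤ A * max x (y ^ 3) ^ 2 := hT εg εH x y gap hεg hεH hx1 hy1 hxε hyε hgap
  have ht0 : (0 : ℝ) ≤ t := Nat.cast_nonneg t
  set Z := max x (y ^ 3) with hZ
  set V := max x (y ^ 4) with hV
  set W := max (x ^ 2) (max (x * y ^ 4) (y ^ 7)) with hWdef
  have hZ0 : 0 ≤ Z := (zero_le_one.trans hx1).trans (le_max_left _ _)
  have hV0 : 0 ≤ V := (zero_le_one.trans hx1).trans (le_max_left _ _)
  have hZV : Z * V ≤ W := max_mul_max_le hx1 hy1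
  have hW0 : 0 ≤ W := (mul_nonneg hZ0 hV0).trans hZV
  have hσ0 : 0 ≤ σ := hσ ▸ Real.sqrt_nonneg _
  have hσA : σ ≤ A₁ * (Z / √ρ) := hσ ▸ sqrt_noise_scale_le hA hρ hcf hρf hZ0 htA
  set Lg := 1 + Real.log x + Real.log (y ^ 2) with hLg
  have hLg1 : 1 ≤ Lg := by
    have := Real.log_nonneg hx1
    have := Real.log_nonneg (one_le_pow₀ hy1 (n := 2))
    linarith
  have hL1 : Real.log (t / ζ) ≤ B₁ * Lg := log_div_le hA hζ hx1 hy1 ht0 htA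
  have hL2 : Real.log p.imax + Real.log (t / ξ) ≤ B₂ * Lg := by
    have h1 : Real.log (t / ξ) ≤ (|Real.log (A / ξ)| + 3) * Lg :=
      log_div_le hA hξ hx1 hy1 ht0 htA
    have h2 : Real.log p.imax ≤ Real.log p.imax * Lg := le_mul_of_one_le_right himax hLg1
    rw [hB₂]; linarith
  set s := √(d : ℝ) with hs
  have hs1 : 1 ≤ s := Real.one_le_sqrt.2 (by exact_mod_cast hd)
  have hsq : s * s = d := Real.mul_self_sqrt (by positivity)
  set N := max 1 (s * εH) with hN
  have hN1 : 1 ≤ N := le_max_left _ _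
  have hρ0 : 0 < √ρ := Real.sqrt_pos.2 hρ
  set P := N * (s / √ρ) * Lg * W with hP
  have hP0 : 0 ≤ P := by positivity
  have hbase : s * (Z / √ρ) * Lg * V ≤ P := by
    calc s * (Z / √ρ) * Lg * V = 1 * (s / √ρ) * Lg * (Z * V) := by ring
      _ ≤ _ := by rw [hP]; gcongr
  have term1 : 2 * √(2 * d) * p.Bg * σ * Real.log (t / ζ) /
      min (p.c1 * εg) (p.c2 / p.M * εH ^ 2) ≤ K₁ * P := by
    have h1 := one_div_min_le hc1 (div_pos hc2 hM) hεg (pow_pos hεH 2) hxε hyε2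
    have hmin : 0 < min (p.c1 * εg) (p.c2 / p.M * εH ^ 2) := lt_min (by positivity) (by positivity)
    rw [Real.sqrt_mul zero_le_two, ← hs, div_eq_mul_one_div]
    calc 2 * (√2 * s) * p.Bg * σ * Real.log (t / ζ) *
          (1 / min (p.c1 * εg) (p.c2 / p.M * εH ^ 2))
        ≤ 2 * (√2 * s) * p.Bg * σ * (B₁ * Lg) *
          (1 / min (p.c1 * εg) (p.c2 / p.M * εH ^ 2)) := by gcongr
      _ ≤ 2 * (√2 * s) * p.Bg * (A₁ * (Z / √ρ)) * (B₁ * Lg) *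
          ((1 / p.c1 + 1 / (p.c2 / p.M)) * V) := by gcongr
      _ = K₁ * (s * (Z / √ρ) * Lg * V) := by rw [hK₁]; ring
      _ ≤ _ := by gcongr
  have term2 : 2 * C * d * p.BH * σ * Real.log (t / ζ) / (p.c * εH) ≤ K₂ * P := by
    have h1 : 1 / (p.c * εH) = y ^ 2 / p.c := by
      field_simp; linarith
    rw [div_eq_mul_one_div, h1]
    calc 2 * C * d * p.BH * σ * Real.log (t / ζ) * (y ^ 2 / p.c)
        ≤ 2 * C * d * p.BH * σ * (B₁ * Lg) * (y ^ 2 / p.c) := by gcongr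
      _ ≤ 2 * C * d * p.BH * (A₁ * (Z / √ρ)) * (B₁ * Lg) * (y ^ 2 / p.c) := by gcongr
      -- One factor √d is paired with ε_H, and y² becomes ε_H y⁴ in exchange.
      _ = K₂ * ((s * εH) * (s / √ρ) * Lg * (Z * y ^ 4)) := by
          rw [hK₂, ← hsq, show y ^ 4 = y ^ 2 * y ^ 2 by ring]
          have : εH = 1 / y ^ 2 := by rw [hysq]; field_simp
          rw [this]
          field_simp
      _ ≤ K₂ * P := by
          have hNle : s * εH ≤ N := le_max_right _ _
          have hy4 : Z * y ^ 4 ≤ W :=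
            (mul_le_mul_of_nonneg_left (le_max_right _ _) hZ0).trans hZV
          rw [hP]
          gcongr
  have term3 : 16 * σ * (Real.log p.imax + Real.log (t / ξ)) * p.Bg *
      max (2 * p.bg / (p.cg * εg)) (4 * p.bH * p.M / (p.t2 * p.cH * εH ^ 2)) ≤ K₃ * P := by
    have h1 : max (2 * p.bg / (p.cg * εg)) (4 * p.bH * p.M / (p.t2 * p.cH * εH ^ 2)) ≤
        (2 * p.bg / p.cg + 4 * p.bH * p.M / (p.t2 * p.cH)) * V := by
      have e1 : 0 < 2 * p.bg / p.cg := by positivity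
      have e2 : 0 < 4 * p.bH * p.M / (p.t2 * p.cH) := by positivity
      refine max_le ?_ ?_
      · calc 2 * p.bg / (p.cg * εg) = 2 * p.bg / p.cg * x := by rw [hx]; field_simp
          _ ≤ _ := by
            gcongr
            · linarith
            · exact le_max_left _ _
      · calc 4 * p.bH * p.M / (p.t2 * p.cH * εH ^ 2)
            = 4 * p.bH * p.M / (p.t2 * p.cH) * y ^ 4 := by
              rw [show y ^ 4 = (y ^ 2) ^ 2 by ring, hysq]; field_simp
          _ ≤ _ := by
            gcongr
            · linarith
            · exact le_max_right _ _
    have h2 : (Z / √ρ) * Lg * V ≤ P := by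
      refine le_trans ?_ hbase
      have h3 : 0 ≤ (Z / √ρ) * Lg * V := by positivity
      linarith [mul_le_mul_of_nonneg_right hs1 h3]
    calc 16 * σ * (Real.log p.imax + Real.log (t / ξ)) * p.Bg *
          max (2 * p.bg / (p.cg * εg)) (4 * p.bH * p.M / (p.t2 * p.cH * εH ^ 2))
        ≤ 16 * σ * (B₂ * Lg) * p.Bg *
          max (2 * p.bg / (p.cg * εg)) (4 * p.bH * p.M / (p.t2 * p.cH * εH ^ 2)) := by
          gcongr
      _ ≤ 16 * (A₁ * (Z / √ρ)) * (B₂ * Lg) * p.Bg *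
          ((2 * p.bg / p.cg + 4 * p.bH * p.M / (p.t2 * p.cH)) * V) := by gcongr
      _ = K₃ * ((Z / √ρ) * Lg * V) := by rw [hK₃]; ring
      _ ≤ _ := by gcongr
  calc p.nMin C d εg εH ζ ξ σ σ σ t ≤ (K₁ + K₂ + K₃ + 1) * P := by
        have h1 : 0 ≤ K₁ * P := by positivity
        have h2 : 0 ≤ K₂ * P := by positivity
        have h3 : 0 ≤ K₃ * P := by positivity
        refine max_le (max_le ?_ ?_) ?_ <;> linarith
    _ = _ := by rw [hP]; ring

/-! ### Probability of success -/

namespace Setup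

variable {X : Type u} {d n : ℕ} {S : Setup X d n} {C ζ ξ : ℝ}

/-- The noise of the first `T` iterations is small. -/
def goodEvent (S : Setup X d n) (C ζ ξ : ℝ) (T : ℕ) : Set (ℕ → IterNoise d) :=
  Set.pi (Finset.range T) fun _ => goodNoise d (√(2 * d) * Real.log (T / ζ)) (C * √d)
    (Real.log S.p.imax + Real.log (T / ξ)) S.p.imax

lemma measurableSet_goodEvent (S : Setup X d n) (C ζ ξ : ℝ) (T : ℕ) :
    MeasurableSet (S.goodEvent C ζ ξ T) :=
  MeasurableSet.pi (Finset.countable_toSet _) fun _ _ => measurableSet_goodNoise _ _ _ _ _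

lemma Admissible.T_pos {z : ℝ} (hζ : 0 < ζ) (h : S.Admissible C ζ ξ z) : 0 < S.T z := by
  have h1 : (0 : ℝ) < S.T z := (by positivity : 0 < Real.exp 1 * ζ).trans_le h.1
  exact_mod_cast h1

lemma Admissible.one_le_log {z : ℝ} (hζ : 0 < ζ) (h : S.Admissible C ζ ξ z) :
    1 ≤ Real.log (S.T z / ζ) := by
  rw [Real.le_log_iff_exp_le (div_pos (by exact_mod_cast h.T_pos hζ) hζ), le_div_iff₀ hζ]
  exact h.1

lemma log_imax_add_log_nonneg (S : Setup X d n) {t : ℝ} (hξ : 0 < ξ) (ht : ξ ≤ t) :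
    0 ≤ Real.log S.p.imax + Real.log (t / ξ) :=
  add_nonneg (Real.log_nonneg (by exact_mod_cast Nat.succ_le_of_lt S.p.imax_pos))
    (Real.log_nonneg ((one_le_div hξ).2 ht))

/-- The levels of `goodEvent` are chosen so that exp(-log(T/ζ)) = ζ/T and imax · exp(-(log imax +
log(T/ξ))) = ξ/T. The conditions on z keep every factor nonnegative, as the T-th power requires. -/
lemma successProb_le_goodEvent (hS : S.Valid) {C₁ : ℝ} (hW : WignerTail C C₁) (hC : 0 < C)
    (hC₁ : 0 < C₁) (hCC : C * Real.exp (-C₁ * C) < 1) {z : ℝ} (hζ : 0 < ζ) (hξ : 0 < ξ)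
    (h : S.Admissible C ζ ξ z) :
    ENNReal.ofReal (successProb C C₁ d ζ ξ (S.T z)) ≤
      noiseLaw d (S.goodEvent C ζ ξ (S.T z)) := by
  have hT : (0 : ℝ) < S.T z := by exact_mod_cast h.T_pos hζ
  have hL := h.one_le_log hζ
  have hd1 : (1 : ℝ) ≤ d := by exact_mod_cast hS.d_pos
  have hCd : C * Real.exp (-C₁ * C * d) ≤ 1 := by
    refine le_trans (mul_le_mul_of_nonneg_left (Real.exp_le_exp.2 ?_) hC.le) hCC.le
    nlinarith [mul_pos hC₁ hC]
  have hexpL : Real.exp (-Real.log (S.T z / ζ)) = ζ / S.T z := by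
    rw [Real.exp_neg, Real.exp_log (by positivity), inv_div]
  have himax : (0 : ℝ) < S.p.imax := by exact_mod_cast S.p.imax_pos
  have hexpℓ : S.p.imax * Real.exp (-(Real.log S.p.imax + Real.log (S.T z / ξ))) =
      ξ / S.T z := by
    rw [neg_add, Real.exp_add, Real.exp_neg, Real.exp_neg, Real.exp_log himax,
      Real.exp_log (by positivity), inv_div]
    field_simp
  have hζT : ζ / S.T z ≤ 1 := hexpL ▸ Real.exp_le_one_iff.2 (by linarith)
  have hξT : ξ / S.T z ≤ 1 := (div_le_one hT).2 h.2.1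
  have key := le_iterNoiseLaw_goodNoise hW hC.le hS.d_pos hCd hL
    (log_imax_add_log_nonneg S hξ h.2.1) S.p.imax_pos hξT hexpℓ
  rw [hexpL] at key
  rw [goodEvent, noiseLaw_pi_range _ _ (measurableSet_goodNoise _ _ _ _ _), successProb,
    ENNReal.ofReal_pow (mul_nonneg (mul_nonneg (by linarith) (by linarith)) (by linarith))]
  exact pow_le_pow_left' key _

lemma smallNoise_of_mem_goodNoise (hS : S.Valid) (hC : 0 < C) {z : ℝ} (hζ : 0 < ζ)
    (h : S.Admissible C ζ ξ z) {ℓ : ℝ} {η : IterNoise d}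
    (hη : η ∈ goodNoise d (√(2 * d) * Real.log (S.T z / ζ)) (C * √d) ℓ S.p.imax) :
    S.SmallNoise (S.T z) ℓ η := by
  obtain ⟨h1, h2, h3, h4⟩ := hη
  have hp := hS.params
  have hn0 : (0 : ℝ) < n := by exact_mod_cast hS.n_pos
  have hL := h.one_le_log hζ
  have hσg := hS.σg_nonneg (S.T z)
  have hσH := hS.σH_nonneg (S.T z)
  refine ⟨?_, ?_, h3, fun i hi => h4 i (by simpa using hi)⟩
  · have h5 := ((le_max_left _ _).trans (le_max_left _ _)).trans h.2.2
    have hmin : 0 < min (S.p.c1 * S.εg) (S.p.c2 / S.p.M * S.εH ^ 2) :=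
      lt_min (mul_pos hp.c1_pos hS.εg_pos)
        (mul_pos (div_pos hp.c2_pos hp.M_pos) (pow_pos hS.εH_pos 2))
    rw [div_le_iff₀ hmin] at h5
    refine (mul_le_mul_of_nonneg_left h1 (mul_nonneg hS.Δg_nonneg hσg)).trans ?_
    rw [Params.Δg, div_mul_eq_mul_div, div_mul_eq_mul_div, div_le_iff₀ hn0]
    linarith
  · have h5 := ((le_max_right _ _).trans (le_max_left _ _)).trans h.2.2
    rw [div_le_iff₀ (mul_pos hp.c_pos hS.εH_pos)] at h5
    refine (mul_le_mul_of_nonneg_left h2 (mul_nonneg hS.ΔH_nonneg hσH)).trans ?_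
    have hsq : √(d : ℝ) * √(d : ℝ) = d := Real.mul_self_sqrt (Nat.cast_nonneg d)
    rw [Params.ΔH, div_mul_eq_mul_div, div_mul_eq_mul_div, div_le_iff₀ hn0]
    have h6 : 0 ≤ 2 * C * d * S.p.BH * S.σH (S.T z) := by
      have := hp.BH_nonneg
      positivity
    calc 2 * S.p.BH * √(d : ℝ) * S.σH (S.T z) * (C * √(d : ℝ))
        = 2 * C * (√(d : ℝ) * √(d : ℝ)) * S.p.BH * S.σH (S.T z) := by ring
      -- The Wigner bound C√d needs no logarithm; the factor log(T/ζ) ≥ 1 in n_min is slack.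
      _ ≤ 2 * C * d * S.p.BH * S.σH (S.T z) * Real.log (S.T z / ζ) := by
          rw [hsq]; exact le_mul_of_one_le_right h6 hL
      _ ≤ _ := by linarith

lemma goodEvent_subset_success (hS : S.Valid) (hC : 0 < C) {z : ℝ} (hζ : 0 < ζ) (hξ : 0 < ξ)
    (h : S.Admissible C ζ ξ z) : S.goodEvent C ζ ξ (S.T z) ⊆ {ω | S.Success z ω} := by
  intro ω hω
  refine success_of_smallNoise hS (h.T_pos hζ) (log_imax_add_log_nonneg S hξ h.2.1)
    ((le_max_right _ _).trans h.2.2) fun j hj => ?_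
  exact smallNoise_of_mem_goodNoise hS hC hζ h (hω j (by simpa using hj))

lemma measurable_T (S : Setup X d n) : Measurable S.T := by
  unfold T Params.iterBound
  exact Nat.measurable_ceil.comp (by fun_prop)

lemma measurableSet_admissible (S : Setup X d n) (C ζ ξ : ℝ) :
    MeasurableSet {z | S.Admissible C ζ ξ z} := by
  have h : {z | S.Admissible C ζ ξ z} = S.T ⁻¹' {t : ℕ | Real.exp 1 * ζ ≤ t ∧ ξ ≤ t ∧
      S.p.nMin C d S.εg S.εH ζ ξ (S.σg t) (S.σH t) (S.lam t) t ≤ n} := rfl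
  rw [h]
  exact S.measurable_T (MeasurableSet.of_discrete)

/-- The success set is not known to be measurable, since `eig` is an arbitrary rule. The estimate
therefore passes through the subset E, which is measurable as a countable union of rectangles
because T takes natural values. -/
lemma lintegral_successProb_le (hS : S.Valid) {C₁ : ℝ} (hW : WignerTail C C₁) (hC : 0 < C)
    (hC₁ : 0 < C₁) (hCC : C * Real.exp (-C₁ * C) < 1) (hζ : 0 < ζ) (hξ : 0 < ξ) :
    ∫⁻ z in {z | S.Admissible C ζ ξ z}, ENNReal.ofReal (successProb C C₁ d ζ ξ (S.T z)) ∂S.zLaw ≤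
      (S.zLaw.prod (noiseLaw d)) {x | S.Admissible C ζ ξ x.1 ∧ S.Success x.1 x.2} := by
  have hadm := S.measurableSet_admissible C ζ ξ
  set E : Set (ℝ × (ℕ → IterNoise d)) :=
    {x | S.Admissible C ζ ξ x.1 ∧ x.2 ∈ S.goodEvent C ζ ξ (S.T x.1)} with hE
  have hEm : MeasurableSet E := by
    have : E = ⋃ t : ℕ, ({z | S.Admissible C ζ ξ z} ∩ S.T ⁻¹' {t}) ×ˢ S.goodEvent C ζ ξ t := by
      ext ⟨z, ω⟩
      simp [hE]
    rw [this]
    exact MeasurableSet.iUnion fun t =>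
      (hadm.inter (S.measurable_T (measurableSet_singleton t))).prod
      (S.measurableSet_goodEvent C ζ ξ t)
  calc _ ≤ ∫⁻ z in {z | S.Admissible C ζ ξ z}, noiseLaw d (Prod.mk z ⁻¹' E) ∂S.zLaw := by
        refine setLIntegral_mono' hadm fun z hz => ?_
        refine (successProb_le_goodEvent hS hW hC hC₁ hCC hζ hξ hz).trans ?_
        exact measure_mono fun ω hω => And.intro hz hω
    _ ≤ ∫⁻ z, noiseLaw d (Prod.mk z ⁻¹' E) ∂S.zLaw := setLIntegral_le_lintegral _ _
    _ = (S.zLaw.prod (noiseLaw d)) E := (Measure.prod_apply hEm).symm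
    _ ≤ _ := measure_mono fun x hx =>
        And.intro hx.1 (goodEvent_subset_success hS hC hζ hξ hx.1 hx.2)

end Setup

end DPOpt

/-! ### Sample complexity with explicit Wigner constants -/

theorem mainTheorem2 :
    ∃ C C₁ : ℝ, 0 < C ∧ 0 < C₁ ∧ C * Real.exp (-C₁ * C) < 1 ∧ DPOpt.WignerTail C C₁ ∧
      (∀ (X : Type u) (d n : ℕ) (S : DPOpt.Setup X d n), S.Valid →
        ∀ ζ ξ : ℝ, 0 < ζ → 0 < ξ →
          (∀ z : ℝ, S.Admissible C ζ ξ z →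
            ENNReal.ofReal (DPOpt.successProb C C₁ d ζ ξ (S.T z)) ≤
              DPOpt.noiseLaw d {ω | S.Success z ω}) ∧
          ∫⁻ z in {z | S.Admissible C ζ ξ z},
              ENNReal.ofReal (DPOpt.successProb C C₁ d ζ ξ (S.T z)) ∂S.zLaw ≤
            (S.zLaw.prod (DPOpt.noiseLaw d))
              {x | S.Admissible C ζ ξ x.1 ∧ S.Success x.1 x.2}) ∧
      (∀ p : DPOpt.Params, p.Valid →
        ∀ ζ ξ F cf : ℝ, 0 < ζ → 0 < ξ → 0 < F → 0 < cf → cf < 1 →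
          ∃ K : ℝ, 0 < K ∧
            ∀ (X : Type u) (d n : ℕ) (S : DPOpt.Setup X d n), S.Valid → S.p = p →
              S.εg ≤ 1 → S.εH ≤ 1 →
              ∀ ρ ρf : ℝ, 0 < ρ → 0 < ρf → ρf ≤ cf * ρ → S.PrivacyChoice ρ ρf →
                ∀ z : ℝ, S.f S.w0 + |z| - S.flow ≤ F →
                  S.nMin C ζ ξ z ≤
                    K * max 1 (Real.sqrt d * S.εH) * (Real.sqrt d / Real.sqrt ρ) *
                      (1 + Real.log (1 / S.εg) + Real.log (1 / S.εH)) *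
                      max (S.εg ^ (-2 : ℝ))
                        (max (S.εg ^ (-1 : ℝ) * S.εH ^ (-2 : ℝ)) (S.εH ^ (-7 / 2 : ℝ)))) := by

  have hCC : (128 : ℝ) * Real.exp (-1 * 128) < 1 := by
    have h := Real.add_one_le_exp (128 : ℝ)
    rw [show (-1 * 128 : ℝ) = -128 by norm_num, Real.exp_neg, ← div_eq_mul_inv,
      div_lt_one (Real.exp_pos _)]
    linarith
  have hC : (0 : ℝ) < 128 := by norm_num
  refine ⟨128, 1, hC, one_pos, hCC, DPOpt.wignerTail, ?_, ?_⟩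
  · intro X d n S hS ζ ξ hζ hξ
    refine ⟨fun z hz => ?_,
      DPOpt.Setup.lintegral_successProb_le hS DPOpt.wignerTail hC one_pos hCC hζ hξ⟩
    exact (DPOpt.Setup.successProb_le_goodEvent hS DPOpt.wignerTail hC one_pos hCC hζ hξ hz).trans
      (measure_mono (DPOpt.Setup.goodEvent_subset_success hS hC hζ hξ hz))
  · intro p hp ζ ξ F cf hζ hξ hF _ hcf
    obtain ⟨K, hK, h⟩ := hp.exists_nMin_le hC.le hζ hξ hF hcf
    refine ⟨K, hK, fun X d n S hS hSp hεg hεH ρ ρf hρ _ hρf hpc z hz => ?_⟩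
    subst hSp
    rw [DPOpt.Setup.nMin, hpc.σg_eq, hpc.σH_eq, hpc.lam_eq]
    exact h d S.εg S.εH _ ρ ρf _ hS.d_pos hS.εg_pos hS.εH_pos hεg hεH hρ hρf hz rfl
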